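/- **Setting.** Let $\lambda,L_{\rm t},L_{\rm r},P,\sigma_{\rm s},\sigma_{\rm c},\alpha_{\rm s}>0$, $d\ge 0$, let $L\ge1$ be an integer, $k_0=2\pi/\lambda$, $\overline\gamma_{\rm s}=P/\sigma_{\rm s}^2$, $\overline\gamma_{\rm c}=P/\sigma_{\rm c}^2$, $\mathcal Z=[\frac d2,\frac d2+L_{\rm t}]$ (transmit aperture) and $\mathcal Z_{\rm r}=[-\frac d2-L_{\rm r},-\frac d2]$ (receive aperture), both on the $z$-axis of $\mathbb R^3$. The user is at $\mathbf p_{\rm c}\in\mathbb R^3$ and the target at $\mathbf p_{\rm s}=(p_x,p_y,p_z)$ with $p_x^2+p_y^2>0$. Put $\hat h_{\rm s}(z)=\frac{e^{-{\rm j}k_0\|(0,0,z)-\mathbf p_{\rm s}\|}}{\sqrt{4\pi}\,\|(0,0,z)-\mathbf p_{\rm s}\|}$. *Sensing rate.* Let $\mathbf s\in\mathbb C^L$ be a random symbol vector with $\frac1L\|\mathbf s\|^2=1$ almost surely. For a beamformer $w\in L^2(\mathcal Z)$ and a detector $v\in L^2(\mathcal Z_{\rm r})$ the detected echo is $$\hat{\mathbf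 y}_{\rm s}=\sqrt P\Big(\int_{\mathcal Z_{\rm r}}v^*\hat h_{\rm s}\Big)\Big(\int_{\mathcal Z}\hat h_{\rm s}w\Big)\mathbf s\,\beta_{\rm s}+\hat{\mathbf n}_{\rm s},$$ with $\beta_{\rm s}\sim\mathcal{CN}(0,\alpha_{\rm s})$, $\hat{\mathbf n}_{\rm s}\sim\mathcal{CN}(0,\sigma_{\rm s}^2\|v\|^2\mathbf I_L)$ and $\mathbf s$ independent. The sensing rate is $\mathcal R_{\rm s}(w)=\sup_v\frac1L I(\hat{\mathbf y}_{\rm s};\beta_{\rm s}\mid\mathbf s)$, in bits. *Channel.* The fading channel $\hat h_{\rm c}$ is a zero-mean circularly symmetric complex Gaussian random field on $\mathcal Z$ with paths in $L^2(\mathcal Z)$, independent of the above, with the autocorrelation of the isotropic plane-wave model $$\hat h_{\rm c}(z)=\frac{1}{(2\pi)^2}\iint_{D\times D}e^{-{\rm j}\mathbf k^{\sf T}\mathbf p_{\rm c}}\,\frac{2\pi/k_0}{\sqrt{\gamma(k_x,k_z)\gamma(\kappa_x,\kappa_z)}}\,W(\mathbf k,\boldsymbol\kappa)\,e^{{\rm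 j}\kappa_z z}\,{\rm d}\mathbf k\,{\rm d}\boldsymbol\kappa,$$ where $\gamma(x,y)=\sqrt{k_0^2-x^2-y^2}$, $D=\{x^2+y^2\le k_0^2\}$, $\mathbf k=(k_x,\gamma(k_x,k_z),k_z)$, $\boldsymbol\kappa=(\kappa_x,\gamma(\kappa_x,\kappa_z),\kappa_z)$ and $W$ is unit complex Gaussian white noise. Let $R_{\rm c}(z,z')=\frac{\sin(k_0(z-z'))}{k_0(z-z')}$ have the eigendecomposition $\sum_{n\ge1}\lambda_n\phi_n(z)\phi_n^*(z')$ on $L^2(\mathcal Z)$, with $\lambda_1\ge\lambda_2\ge\dots\ge0$ and orthonormal $\phi_n$. Let $\mathsf{DoF}$ be a positive integer with $|\mathsf{DoF}-2L_{\rm t}/\lambda|<1$ (that is, $2L_{\rm t}/\lambda$ itself if it is an integer, and otherwise $2L_{\rm t}/\lambda$ rounded up or down). The channel is replaced by its finite-DoF version $h_{\rm c}=\sum_{n=1}^{\mathsf{DoF}}\langle\phi_n,\hat h_{\rm c}\rangle\phi_n$. *C-C design.* The beamformer $w_{\rm c}$ maximizes, for almost every channel realization, the communication rate $\log_2\big(1+\overline\gamma_{\rm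 c}\big|\int_{\mathcal Z}h_{\rm c}w\big|^2\big)$ subject to $\int_{\mathcal Z}|w|^2=1$. The average sensing rate is $\overline{\mathcal R}_{\rm s}^{\rm c}=\mathbb E\{\mathcal R_{\rm s}(w_{\rm c})\}$. *Operator $Q$.* Put $\tilde R_{\rm c}(z,z')=\sum_{n=1}^{\mathsf{DoF}}\sqrt{\lambda_n}\,\phi_n(z)\phi_n^*(z')$ and $$Q(z_1,z_2)=\int_{\mathcal Z}\int_{\mathcal Z}\tilde R_{\rm c}(z_1,z)\big(\delta(z-z')+L\alpha_{\rm s}\overline\gamma_{\rm s}G_{\rm r}\hat h_{\rm s}(z)\hat h_{\rm s}^*(z')\big)\tilde R_{\rm c}(z',z_2)\,{\rm d}z\,{\rm d}z',$$ $$G_{\rm r}=\frac{1}{4\pi\sqrt{p_x^2+p_y^2}}\Big(\arctan\frac{-d/2-p_z}{\sqrt{p_x^2+p_y^2}}-\arctan\frac{-d/2-L_{\rm r}-p_z}{\sqrt{p_x^2+p_y^2}}\Big).$$ Let $\nu_1\ge\nu_2\ge\dots\ge0$ be the eigenvalues of $Q$ on $L^2(\mathcal Z)$ with multiplicity, and $\mathsf{DoF}_Q$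 the number of nonzero ones. For a nonincreasing sequence $a_1\ge a_2\ge\dots\ge0$ and $N\ge1$ with $a_N>0$, let $\xi_0(a,N)=1$ and $\xi_m(a,N)=\frac1m\sum_{i=1}^m\xi_{m-i}(a,N)\sum_{n=1}^N(1-a_N/a_n)^i$ for $m\ge1$, and let $\psi=(\ln\Gamma)'$. **Theorem 6.** Under the C-C design, $\mathcal R_{\rm s}(w_{\rm c})$ is integrable, the two series below converge absolutely, and $$\overline{\mathcal R}_{\rm s}^{\rm c}=\frac{\nu_{\mathsf{DoF}_Q}^{\mathsf{DoF}_Q}\log_2 e}{L\prod_{n=1}^{\mathsf{DoF}_Q}\nu_n}\sum_{m=0}^\infty\xi_m(\nu,\mathsf{DoF}_Q)\big(\psi(\mathsf{DoF}_Q+m)+\ln\nu_{\mathsf{DoF}_Q}\big)-\frac{\lambda_{\mathsf{DoF}}^{\mathsf{DoF}}\log_2 e}{L\prod_{n=1}^{\mathsf{DoF}}\lambda_n}\sum_{m=0}^\infty\xi_m(\lambda,\mathsf{DoF})\big(\psi(\mathsf{DoF}+m)+\ln\lambda_{\mathsf{DoF}}\big).$$ -/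

import Mathlib

open MeasureTheory ProbabilityTheory
open scoped ComplexConjugate

noncomputable section

namespace CAPA

/-! ### Probabilistic and information-theoretic notions -/

/-- The circularly symmetric complex Gaussian law `CN(0, v)`: real and imaginary parts are
independent centred real Gaussians of variance `v / 2`. -/
def complexGaussian (v : ℝ) : Measure ℂ :=
  ((gaussianReal 0 (v / 2).toNNReal).prod (gaussianReal 0 (v / 2).toNNReal)).map
    (fun p : ℝ × ℝ => (p.1 : ℂ) + (p.2 : ℂ) * Complex.I)

/-- Mutual information, in nats, between the two components of a pair with joint law `ρ`:
the relative entropy of the joint law with respect to the product of its marginals. -/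
def mutualInfo {X Y : Type*} [MeasurableSpace X] [MeasurableSpace Y] (ρ : Measure (X × Y)) :
    ENNReal :=
  InformationTheory.klDiv ρ (ρ.fst.prod ρ.snd)

/-- The space `L²(A)` of square-integrable complex functions on a set `A` of reals. -/
abbrev L2 (A : Set ℝ) : Type := Lp ℂ 2 (volume.restrict A)

/-- The sesquilinear form `∬ f(z)^* K(z,z') g(z') dz' dz` of an integral kernel on `A`. -/
def kernelForm (A : Set ℝ) (K : ℝ → ℝ → ℂ) (f g : L2 A) : ℂ :=
  ∫ z in A, ∫ z' in A, conj (f z) * K z z' * g z'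

/-- `h` is a zero-mean circularly symmetric complex Gaussian random field on `A`, with paths in
`L²(A)` and with autocorrelation `E[h(z) h(z')^*] = R z z'`: every linear functional
`∫ f(z)^* h(z) dz` has law `CN(0, ∬ f(z)^* R(z,z') f(z') dz' dz)`. -/
def IsCircGaussianField {Ω : Type*} [MeasurableSpace Ω] (μ : Measure Ω) (A : Set ℝ)
    (R : ℝ → ℝ → ℂ) (h : Ω → L2 A) : Prop :=
  ∀ f : L2 A, μ.map (fun ω => inner ℂ f (h ω)) = complexGaussian (kernelForm A R f f).re

/-- `K(z,z') = ∑ₙ aₙ φₙ(z) φₙ(z')^*` is an eigendecomposition of the positive kernel `K` on `A`: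
the `φₙ` are orthonormal in `L²(A)`, the eigenvalues are `a 0 ≥ a 1 ≥ … ≥ 0` (repeated according to
multiplicity), and the expansion holds in the sense of sesquilinear forms on `L²(A)`. -/
structure IsKernelEVD (A : Set ℝ) (K : ℝ → ℝ → ℂ) (a : ℕ → ℝ) (φ : ℕ → L2 A) : Prop where
  antitone : Antitone a
  nonneg : ∀ n, 0 ≤ a n
  orthonormal : Orthonormal ℂ φ
  expansion : ∀ f g : L2 A,
    HasSum (fun n => (a n : ℂ) * inner ℂ f (φ n) * inner ℂ (φ n) g) (kernelForm A K f g)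

/-- The number of nonzero terms of a sequence of eigenvalues. -/
def numNonzero (a : ℕ → ℝ) : ℕ := Set.ncard {n | a n ≠ 0}

/-! ### The digamma series -/

/-- The digamma function `ψ = (ln Γ)'`. -/
def digamma (x : ℝ) : ℝ := deriv (fun y => Real.log (Real.Gamma y)) x

/-- The coefficients `ξ_m` attached to the `N` leading terms `a 0, …, a (N-1)` of a sequence:
`ξ_0 = 1` and `ξ_m = (1/m) ∑_{i=1}^m ξ_{m-i} ∑_{n<N} (1 - a (N-1) / a n)^i` for `m > 0`. -/
def xi (a : ℕ → ℝ) (N : ℕ) : ℕ → ℝ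
  | 0 => 1
  | m + 1 => (1 / ((m : ℝ) + 1)) * ∑ i : Fin (m + 1),
      xi a N (m - i) * ∑ n ∈ Finset.range N, (1 - a (N - 1) / a n) ^ ((i : ℕ) + 1)
  termination_by m => m
  decreasing_by omega

/-- The `m`-th term `ξ_m (ψ(N + m) + ln a_N)` of the series (the `N`-th term of the sequence has
index `N - 1`). -/
def seriesTerm (a : ℕ → ℝ) (N m : ℕ) : ℝ :=
  xi a N m * (digamma ((N : ℝ) + m) + Real.log (a (N - 1)))

/-- The prefactor `a_N ^ N / ∏_{n ≤ N} a_n`. -/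
def seriesPrefactor (a : ℕ → ℝ) (N : ℕ) : ℝ :=
  a (N - 1) ^ N / ∏ n ∈ Finset.range N, a n

/-! ### The system -/

/-- The physical parameters of the system: wavelength, aperture lengths, separation of the
apertures, transmit power, noise levels `σ_s`, `σ_c`, mean power `α_s` of the radar cross section,
frame length, and the positions of the target (off the array axis) and of the user. -/
structure System where
  wavelength : ℝ
  Lt : ℝ
  Lr : ℝ
  d : ℝ
  P : ℝ
  σs : ℝ
  σc : ℝ
  αs : ℝ
  L : ℕ
  ps : EuclideanSpace ℝ (Fin 3)
  pc : EuclideanSpace ℝ (Fin 3)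
  wavelength_pos : 0 < wavelength
  Lt_pos : 0 < Lt
  Lr_pos : 0 < Lr
  d_nonneg : 0 ≤ d
  P_pos : 0 < P
  σs_pos : 0 < σs
  σc_pos : 0 < σc
  αs_pos : 0 < αs
  L_pos : 0 < L
  ps_off_axis : 0 < ps 0 ^ 2 + ps 1 ^ 2

namespace System

variable (S : System)

/-- The wavenumber. -/
def k0 : ℝ := 2 * Real.pi / S.wavelength

/-- The `z`-coordinates of the transmit aperture. -/
def Zt : Set ℝ := Set.Icc (S.d / 2) (S.d / 2 + S.Lt)

/-- The `z`-coordinates of the receive aperture. -/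
def Zr : Set ℝ := Set.Icc (-S.d / 2 - S.Lr) (-S.d / 2)

/-- The point of the array axis with coordinate `z`. -/
def axisPoint (z : ℝ) : EuclideanSpace ℝ (Fin 3) := !₂[0, 0, z]

/-- The transmit signal-to-noise ratio for sensing. -/
def γs : ℝ := S.P / S.σs ^ 2

/-- The transmit signal-to-noise ratio for communications. -/
def γc : ℝ := S.P / S.σc ^ 2

/-! #### Sensing -/

/-- The line-of-sight spherical-wave link between the target and the point of the array axis with
coordinate `z`. -/
def hs (z : ℝ) : ℂ :=
  Complex.exp (-(Complex.I * S.k0 * ‖axisPoint z - S.ps‖)) /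
    (Real.sqrt (4 * Real.pi) * ‖axisPoint z - S.ps‖)

/-- Effective transmit gain `∫ h_s(t) w(t) dt` of a beamformer `w`. -/
def txGain (w : L2 S.Zt) : ℂ := ∫ z in S.Zt, S.hs z * w z

/-- Effective receive gain `∫ v(r)^* h_s(r) dr` of a detector `v`. -/
def rxGain (v : L2 S.Zr) : ℂ := ∫ z in S.Zr, conj (v z) * S.hs z

/-- Given the symbols `s`, the joint law of the detected echo
`√P (∫ v^* h_s) (∫ h_s w) s β + n ∈ ℂ^L` and of the radar cross section `β ~ CN(0, α_s)`, where the
detected noise `n ~ CN(0, σ_s² ‖v‖² I_L)` is independent of `β`. -/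
def echoLaw (w : L2 S.Zt) (v : L2 S.Zr) (s : Fin S.L → ℂ) : Measure ((Fin S.L → ℂ) × ℂ) :=
  ((complexGaussian S.αs).prod
      (Measure.pi fun _ : Fin S.L => complexGaussian (S.σs ^ 2 * ‖v‖ ^ 2))).map
    (fun p : ℂ × (Fin S.L → ℂ) =>
      ((fun l => Real.sqrt S.P * S.rxGain v * S.txGain w * s l * p.1 + p.2 l), p.1))

/-- The sensing mutual information (in nats) between the detected echo and the radar cross section,
conditional on the symbol vector, whose law is `κ`. -/
def sensingMI (κ : Measure (Fin S.L → ℂ)) (w : L2 S.Zt) (v : L2 S.Zr) : ENNReal :=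
  ∫⁻ s, mutualInfo (S.echoLaw w v s) ∂κ

/-- The sensing rate of a beamformer, in bits per symbol: mutual information per unit time, for the
best detector. -/
def sensingRate (κ : Measure (Fin S.L → ℂ)) (w : L2 S.Zt) : ℝ :=
  (1 / (S.L : ℝ)) * ((⨆ v : L2 S.Zr, S.sensingMI κ w v).toReal / Real.log 2)

/-- `ζ(x,y)`: the angle under which the target sees the segment `[x,y]` of the array axis. -/
def viewAngle (x y : ℝ) : ℝ :=
  Real.arctan ((y - S.ps 2) / Real.sqrt (S.ps 0 ^ 2 + S.ps 1 ^ 2)) -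
    Real.arctan ((x - S.ps 2) / Real.sqrt (S.ps 0 ^ 2 + S.ps 1 ^ 2))

/-- The closed form `G_r` of the receive array gain. -/
def Gr : ℝ :=
  S.viewAngle (-S.d / 2 - S.Lr) (-S.d / 2) /
    (4 * Real.pi * Real.sqrt (S.ps 0 ^ 2 + S.ps 1 ^ 2))

/-! #### The fading communication channel -/

/-- The `y`-component `γ(k_x,k_z)` of a propagating wave vector. -/
def waveY (k : ℝ × ℝ) : ℝ := Real.sqrt (S.k0 ^ 2 - k.1 ^ 2 - k.2 ^ 2)

/-- The disk of pairs `(k_x,k_z)` of propagating waves. -/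
def waveDisk : Set (ℝ × ℝ) := {k | k.1 ^ 2 + k.2 ^ 2 ≤ S.k0 ^ 2}

/-- The wave vector with `x`- and `z`-components `k`. -/
def waveVec (k : ℝ × ℝ) : EuclideanSpace ℝ (Fin 3) := !₂[k.1, S.waveY k, k.2]

/-- The amplitude with which unit white noise in the pair of directions `(k, κ)` contributes to the
response between the user and the aperture point `z`, under isotropic scattering. -/
def planeWave (z : ℝ) (k κ : ℝ × ℝ) : ℂ :=
  (1 / (2 * Real.pi) ^ 2 : ℝ) *
    Complex.exp (-(Complex.I * (inner ℝ (S.waveVec k) S.pc : ℝ))) *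
    ((2 * Real.pi / S.k0) / Real.sqrt (S.waveY k * S.waveY κ) : ℝ) *
    Complex.exp (Complex.I * (inner ℝ (S.waveVec κ) (axisPoint z) : ℝ))

/-- Autocorrelation `E[h_c(z) h_c(z')^*]` of the multipath channel
`h_c(z) = ∬ planeWave z k κ W(k,κ) dk dκ` driven by the white noise `W`,
`E[W(k,κ) W(k',κ')^*] = δ(k-k') δ(κ-κ')`. -/
def channelCorr (z z' : ℝ) : ℂ :=
  ∫ k in S.waveDisk, ∫ κ in S.waveDisk, S.planeWave z k κ * conj (S.planeWave z' k κ)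

/-- The sinc kernel `sin (k₀ (z - z')) / (k₀ (z - z'))`. -/
def sincKernel (z z' : ℝ) : ℂ := (Real.sinc (S.k0 * (z - z')) : ℝ)

/-- The part of a channel realization carried by the first `N` modes `φ`. -/
def truncate (φ : ℕ → L2 S.Zt) (N : ℕ) (h : L2 S.Zt) : L2 S.Zt :=
  ∑ n ∈ Finset.range N, (inner ℂ (φ n) h : ℂ) • φ n

/-! #### The communications-centric design -/

/-- The communication rate of a beamformer `w` over a channel realization `h`. -/
def commRate (h w : L2 S.Zt) : ℝ :=
  Real.logb 2 (1 + S.γc * ‖∫ z in S.Zt, h z * w z‖ ^ 2)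

/-- `w` is a communications-centric beamformer for the channel realization `h`: it maximizes the
communication rate among the beamformers of unit energy. -/
def IsCCBeamformer (h w : L2 S.Zt) : Prop :=
  ‖w‖ = 1 ∧ ∀ w' : L2 S.Zt, ‖w'‖ = 1 → S.commRate h w' ≤ S.commRate h w

/-- The kernel `∑_{n ≤ N} √λ_n φ_n(z) φ_n(z')^*`. -/
def sqrtKernel (lam : ℕ → ℝ) (φ : ℕ → L2 S.Zt) (N : ℕ) (z z' : ℝ) : ℂ :=
  ∑ n ∈ Finset.range N, (Real.sqrt (lam n) : ℂ) * φ n z * conj (φ n z')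

/-- The kernel
`Q(z₁,z₂) = ∬ R̃(z₁,z) (δ(z-z') + L α_s γ_s G_r h_s(z) h_s(z')^*) R̃(z',z₂) dz dz'`,
where `R̃` is `sqrtKernel`. -/
def Qkernel (lam : ℕ → ℝ) (φ : ℕ → L2 S.Zt) (N : ℕ) (z₁ z₂ : ℝ) : ℂ :=
  (∫ z in S.Zt, S.sqrtKernel lam φ N z₁ z * S.sqrtKernel lam φ N z z₂) +
    ((S.L : ℝ) * S.αs * S.γs * S.Gr : ℝ) *
      (∫ z in S.Zt, S.sqrtKernel lam φ N z₁ z * S.hs z) *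
      (∫ z' in S.Zt, conj (S.hs z') * S.sqrtKernel lam φ N z' z₂)

end System

end CAPA

end

/-!
Writing `x_n = ⟨φ_n, h_c⟩` for the coordinates of the fading channel, a matched beamformer turns the
sensing rate into a difference of logarithms of two positive quadratic forms in the `x_n`. Each
form, diagonalized, is a weighted sum of independent unit exponential variables, and the mean
logarithm of such a sum is a digamma series.

*Sensing rate.* Given the symbols, the echo is a linear Gaussian observation of `β_s`. With the
optimal detector (Cauchy–Schwarz) this gives
`R_s(w) = (1/L) log₂ (1 + L α_s γ_s G_r |∫ h_s w|²)` (`System.sensingRate_eq`), where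
`G_r = ∫ |h_s|²` over the receive aperture. The mutual information is computed by changing measure
to the product law with the Cameron–Martin density (`mutualInfo_linear_complexGaussian`).

*Beamformer.* For a channel `h ≠ 0` the equality case of Cauchy–Schwarz gives
`|∫ h_s w_c|² = |⟨h_s, h⟩|² / ‖h‖²` (`System.norm_txGain_sq`). With `c = L α_s γ_s G_r`, the rate is
therefore `(1/L) (log₂ (‖h‖² + c |⟨h_s, h⟩|²) - log₂ ‖h‖²)`.

*Quadratic forms.* Integrating out the propagation directions, the channel autocorrelation is the
sinc kernel (`System.channelCorr_eq`), so the `x_n` are independent `CN(0, λ_n)` variables. All `λ_n`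
are positive, because a nonzero polynomial on an interval has a Fourier transform that does not
vanish on a band (`System.lam_pos`). After the rescaling `g = ∑ (x_n / √λ_n) φ_n`, the coordinates
of `g` in any orthonormal basis of the span of the first `N` modes are independent `CN(0, 1)`
variables (`System.map_inner_whiten`). In the basis `φ`, `‖h‖² = ∑ λ_n |⟨φ_n, g⟩|²`. The form
`‖h‖² + c |⟨h_s, h⟩|²` is the form of `Q` at `g`, and in the eigenbasis of `Q` it becomes
`∑ ν_k |⟨χ_k, g⟩|²` (`System.norm_truncate_sq_add`). The kernel `Q` has exactly `N` nonzero
eigenvalues, by comparing dimensions (`System.numNonzero_Qkernel`).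

*Digamma series.* The recursion for `ξ` says that `∑ ξ_m X^m = ∏ (1 - (1 - a_N / a_n) X)⁻¹`
(`xi_eq_coeff`). Evaluated at `X = (1 - i t a_N)⁻¹`, this identifies the characteristic function of
`∑ a_n |z_n|²` with that of the mixture of the laws `Gamma(N + m, 1 / a_N)` with weights
`a_N^N ξ_m / ∏ a_n` (`pi_complexGaussian_map_sum_norm_sq`). The mean of the logarithm under
`Gamma(k, r)` is `ψ(k) - ln r`. The logarithm is integrable under the mixture, so the series of its
means converges absolutely, and it sums to the mean logarithm (`hasSum_seriesTerm`).
-/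

open MeasureTheory ProbabilityTheory
open scoped ComplexConjugate

namespace CAPA

/-! ### The complex Gaussian law -/

instance (v : ℝ) : IsProbabilityMeasure (complexGaussian v) := by
  unfold complexGaussian
  exact Measure.isProbabilityMeasure_map (by fun_prop)

lemma integral_complexGaussian {E : Type*} [NormedAddCommGroup E] [NormedSpace ℝ E] (v : ℝ)
    {f : ℂ → E} (hf : AEStronglyMeasurable f (complexGaussian v)) :
    ∫ z, f z ∂complexGaussian v =
      ∫ p : ℝ × ℝ, f ((p.1 : ℂ) + (p.2 : ℂ) * Complex.I)
        ∂((gaussianReal 0 (v / 2).toNNReal).prod (gaussianReal 0 (v / 2).toNNReal)) := by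
  unfold complexGaussian
  exact integral_map (by fun_prop) hf

lemma charFun_complexGaussian {v : ℝ} (hv : 0 ≤ v) (t : ℂ) :
    charFun (complexGaussian v) t = Complex.exp (-(v * ‖t‖ ^ 2 / 4 : ℝ)) := by
  rw [charFun_apply, integral_complexGaussian v (by fun_prop)]
  have h1 : ∀ p : ℝ × ℝ, Complex.exp (inner ℝ ((p.1 : ℂ) + (p.2 : ℂ) * Complex.I) t * Complex.I)
      = Complex.exp (t.re * p.1 * Complex.I) * Complex.exp (t.im * p.2 * Complex.I) := by
    intro p
    rw [← Complex.exp_add, Complex.inner]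
    congr 1
    simp
    ring
  simp_rw [h1]
  rw [integral_prod_mul (fun x : ℝ => Complex.exp (t.re * x * Complex.I))
    (fun x : ℝ => Complex.exp (t.im * x * Complex.I)), ← charFun_apply_real,
    ← charFun_apply_real, charFun_gaussianReal, charFun_gaussianReal, ← Complex.exp_add]
  congr 1
  have : ((v / 2).toNNReal : ℂ) = v / 2 := by
    have h : (((v / 2).toNNReal : ℝ) : ℂ) = ((v / 2 : ℝ) : ℂ) := by
      rw [Real.coe_toNNReal _ (by positivity)]
    rw [h]; simp
  rw [this, ← Complex.normSq_eq_norm_sq, Complex.normSq_apply]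
  push_cast
  ring

/-- The density of `CN(0, v)` with respect to Lebesgue measure on `ℂ`. -/
noncomputable def complexGaussianPDF (v : ℝ) (z : ℂ) : ℝ :=
  Real.exp (-(‖z‖ ^ 2 / v)) / (Real.pi * v)

@[fun_prop]
lemma continuous_complexGaussianPDF (v : ℝ) : Continuous (complexGaussianPDF v) := by
  unfold complexGaussianPDF
  fun_prop

lemma complexGaussianPDF_pos {v : ℝ} (hv : 0 < v) (z : ℂ) : 0 < complexGaussianPDF v z := by
  unfold complexGaussianPDF
  positivity

lemma complexGaussian_eq_withDensity {v : ℝ} (hv : 0 < v) :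
    complexGaussian v = volume.withDensity (fun z => ENNReal.ofReal (complexGaussianPDF v z)) := by
  have hv0 : (v / 2).toNNReal ≠ 0 := by simpa using hv
  have hm := Complex.volume_preserving_equiv_real_prod.symm
  unfold complexGaussian
  rw [gaussianReal_of_var_ne_zero _ hv0,
    prod_withDensity (measurable_gaussianPDF _ _) (measurable_gaussianPDF _ _)]
  have h1 : (fun p : ℝ × ℝ => (p.1 : ℂ) + (p.2 : ℂ) * Complex.I) =
      Complex.measurableEquivRealProd.symm := by
    ext p
    simp [Complex.measurableEquivRealProd_symm_apply, Complex.ext_iff]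
  rw [h1]
  ext s hs
  rw [MeasurableEquiv.map_apply, withDensity_apply _ (by measurability), withDensity_apply _ hs,
    ← hm.setLIntegral_comp_preimage hs (by fun_prop)]
  refine lintegral_congr fun p => ?_
  rw [gaussianPDF, gaussianPDF, ← ENNReal.ofReal_mul (gaussianPDFReal_nonneg _ _ _)]
  congr 1
  have h2 : ‖Complex.measurableEquivRealProd.symm p‖ ^ 2 = p.1 ^ 2 + p.2 ^ 2 := by
    rw [← Complex.normSq_eq_norm_sq, Complex.normSq_apply, Complex.measurableEquivRealProd_symm_apply]
    ring
  rw [complexGaussianPDF, h2, gaussianPDFReal, gaussianPDFReal, Real.coe_toNNReal _ (by positivity)]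
  rw [mul_mul_mul_comm, ← Real.exp_add, ← mul_inv, Real.mul_self_sqrt (by positivity)]
  rw [div_eq_mul_inv, mul_comm]
  congr 1
  · congr 1; ring
  · congr 1; field_simp

lemma lintegral_complexGaussianPDF {v : ℝ} (hv : 0 < v) :
    ∫⁻ z, ENNReal.ofReal (complexGaussianPDF v z) = 1 := by
  have := measure_univ (μ := complexGaussian v)
  rwa [complexGaussian_eq_withDensity hv, withDensity_apply _ .univ, Measure.restrict_univ] at this

/-- **Cameron–Martin**: the density of a translate of `CN(0, v)`. -/
lemma complexGaussian_map_const_add {v : ℝ} (hv : 0 < v) (m : ℂ) :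
    (complexGaussian v).map (fun z => m + z) = (complexGaussian v).withDensity
      (fun z => ENNReal.ofReal (Real.exp ((2 * (conj m * z).re - ‖m‖ ^ 2) / v))) := by
  rw [complexGaussian_eq_withDensity hv, ← withDensity_mul _ (by fun_prop) (by fun_prop)]
  ext s hs
  rw [Measure.map_apply (by fun_prop) hs, withDensity_apply _ (by measurability),
    withDensity_apply _ hs,
    ← (measurePreserving_add_left volume m).setLIntegral_comp_preimage hs (by fun_prop)]
  refine lintegral_congr fun z => ?_
  simp only [Pi.mul_apply]
  rw [← ENNReal.ofReal_mul (complexGaussianPDF_pos hv _).le]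
  congr 1
  rw [complexGaussianPDF, complexGaussianPDF, div_mul_eq_mul_div, ← Real.exp_add]
  congr 2
  rw [← Complex.normSq_eq_norm_sq, ← Complex.normSq_eq_norm_sq, ← Complex.normSq_eq_norm_sq]
  simp [Complex.normSq_apply]
  field_simp
  ring

/-- The Gaussian integral of the exponential of a quadratic form, by completing the square. -/
lemma lintegral_exp_complexGaussian {a s q : ℝ} (ha : 0 < a) (hs : 0 < s) (hq : 0 ≤ q) (t : ℂ) :
    ∫⁻ z, ENNReal.ofReal (Real.exp ((2 * (conj z * t).re - q * ‖z‖ ^ 2) / s)) ∂complexGaussian a =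
      ENNReal.ofReal (Real.exp (‖t‖ ^ 2 * a / (s * (s + a * q))) * (s / (s + a * q))) := by
  have hw : 0 < a * s / (s + a * q) := by positivity
  have hD : 0 < s + a * q := by positivity
  set w := a * s / (s + a * q) with hwdef
  rw [complexGaussian_eq_withDensity ha,
    lintegral_withDensity_eq_lintegral_mul _ (by fun_prop) (by fun_prop)]
  have h1 : ∀ z : ℂ, ((fun z => ENNReal.ofReal (complexGaussianPDF a z)) * fun z =>
      ENNReal.ofReal (Real.exp ((2 * (conj z * t).re - q * ‖z‖ ^ 2) / s))) z =
      ENNReal.ofReal (Real.exp (‖t‖ ^ 2 * a / (s * (s + a * q))) * (s / (s + a * q))) *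
      ENNReal.ofReal (complexGaussianPDF w (-((w / s : ℝ) * t) + z)) := by
    intro z
    simp only [Pi.mul_apply]
    rw [← ENNReal.ofReal_mul (complexGaussianPDF_pos ha _).le, ← ENNReal.ofReal_mul (by positivity)]
    congr 1
    have e1 : ∀ x y c e : ℝ, x * c * (y / e) = x * y * (c / e) := fun x y c e => by ring
    have e2 : s / (s + a * q) / (Real.pi * w) = 1 / (Real.pi * a) := by
      rw [hwdef]; field_simp
    rw [complexGaussianPDF, complexGaussianPDF, div_mul_eq_mul_div, ← Real.exp_add, e1,
      ← Real.exp_add, e2, mul_one_div]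
    congr 2
    rw [← Complex.normSq_eq_norm_sq, ← Complex.normSq_eq_norm_sq, ← Complex.normSq_eq_norm_sq]
    simp only [Complex.normSq_apply, Complex.add_re, Complex.add_im, Complex.neg_re, Complex.neg_im,
      Complex.mul_re, Complex.mul_im, Complex.ofReal_re, Complex.ofReal_im, Complex.conj_re,
      Complex.conj_im]
    rw [hwdef]
    field_simp
    ring
  simp_rw [h1]
  rw [lintegral_const_mul _ (by fun_prop),
    lintegral_add_left_eq_self (fun z => ENNReal.ofReal (complexGaussianPDF w z)),
    lintegral_complexGaussianPDF hw, mul_one]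

/-! ### Linear functionals and moments -/

lemma charFun_map_re_mul_complexGaussian {v : ℝ} (hv : 0 ≤ v) (a : ℂ) (t : ℝ) :
    ∫ z, Complex.exp (t * (a * z).re * Complex.I) ∂complexGaussian v =
      Complex.exp (-(v * ‖a‖ ^ 2 * t ^ 2 / 4 : ℝ)) := by
  have h := charFun_complexGaussian hv (conj a * t)
  rw [charFun_apply] at h
  have h1 : ∀ z : ℂ, Complex.exp (t * (a * z).re * Complex.I) =
      Complex.exp (inner ℝ z (conj a * t) * Complex.I) := by
    intro z
    rw [Complex.inner]
    congr 2
    rw [← Complex.ofReal_mul]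
    congr 1
    simp
    ring
  simp_rw [h1]
  rw [h]
  congr 3
  simp [mul_pow]
  ring

section

variable {ι : Type*} [Fintype ι]

lemma measurable_re_sum_mul (a : ι → ℂ) : Measurable fun n : ι → ℂ => (∑ l, a l * n l).re :=
  Complex.measurable_re.comp (by fun_prop)

/-- A linear functional of independent `CN(0, v)` variables has a Gaussian real part. -/
lemma pi_complexGaussian_map_re_sum {v : ℝ} (hv : 0 ≤ v) (a : ι → ℂ) :
    (Measure.pi fun _ : ι => complexGaussian v).map (fun n => (∑ l, a l * n l).re) =
      gaussianReal 0 (v / 2 * ∑ l, ‖a l‖ ^ 2).toNNReal := by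
  have hm : Measurable (fun n : ι → ℂ => (∑ l, a l * n l).re) := by fun_prop
  have := Measure.isProbabilityMeasure_map (μ := Measure.pi fun _ : ι => complexGaussian v)
    hm.aemeasurable
  refine Measure.ext_of_charFun (funext fun t => ?_)
  rw [charFun_apply_real, integral_map hm.aemeasurable (by fun_prop), charFun_gaussianReal]
  have h1 : ∀ n : ι → ℂ, Complex.exp (t * ((∑ l, a l * n l).re : ℝ) * Complex.I) =
      ∏ l, Complex.exp (t * (a l * n l).re * Complex.I) := by
    intro n
    rw [← Complex.exp_sum, Complex.re_sum, ← Finset.sum_mul, Complex.ofReal_sum, Finset.mul_sum]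
  simp_rw [h1]
  rw [integral_fintype_prod_eq_prod
    (f := fun l z => Complex.exp ((t : ℂ) * ((a l * z).re : ℝ) * Complex.I))]
  simp_rw [charFun_map_re_mul_complexGaussian hv]
  rw [← Complex.exp_sum]
  congr 1
  have h2 : (((v / 2 * ∑ l, ‖a l‖ ^ 2).toNNReal : ℝ) : ℂ) = ((v / 2 * ∑ l, ‖a l‖ ^ 2 : ℝ) : ℂ) := by
    rw [Real.coe_toNNReal _ (by positivity)]
  rw [h2]
  push_cast
  rw [Finset.sum_neg_distrib, ← Finset.sum_div, ← Finset.sum_mul, ← Finset.mul_sum]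
  ring

lemma memLp_re_sum_pi_complexGaussian {v : ℝ} (hv : 0 ≤ v) (a : ι → ℂ) :
    MemLp (fun n : ι → ℂ => (∑ l, a l * n l).re) 2 (Measure.pi fun _ : ι => complexGaussian v) := by
  have h := memLp_id_gaussianReal (μ := 0) (v := (v / 2 * ∑ l, ‖a l‖ ^ 2).toNNReal) 2
  rw [← pi_complexGaussian_map_re_sum hv a] at h
  exact (memLp_map_measure_iff (g := id) (by fun_prop) (measurable_re_sum_mul a).aemeasurable).1 h

lemma integral_re_sum_pi_complexGaussian {v : ℝ} (hv : 0 ≤ v) (a : ι → ℂ) :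
    ∫ n : ι → ℂ, (∑ l, a l * n l).re ∂(Measure.pi fun _ : ι => complexGaussian v) = 0 := by
  have h := integral_id_gaussianReal (μ := 0) (v := (v / 2 * ∑ l, ‖a l‖ ^ 2).toNNReal)
  rwa [← pi_complexGaussian_map_re_sum hv a, integral_map (measurable_re_sum_mul a).aemeasurable (by fun_prop)] at h

lemma integral_re_sum_sq_pi_complexGaussian {v : ℝ} (hv : 0 ≤ v) (a : ι → ℂ) :
    ∫ n : ι → ℂ, (∑ l, a l * n l).re ^ 2 ∂(Measure.pi fun _ : ι => complexGaussian v) =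
      v / 2 * ∑ l, ‖a l‖ ^ 2 := by
  have h := variance_of_integral_eq_zero (X := fun x : ℝ => x) (by fun_prop)
    (integral_id_gaussianReal (μ := 0) (v := (v / 2 * ∑ l, ‖a l‖ ^ 2).toNNReal))
  rw [variance_fun_id_gaussianReal, Real.coe_toNNReal _ (by positivity),
    ← pi_complexGaussian_map_re_sum hv a, integral_map (measurable_re_sum_mul a).aemeasurable (by fun_prop)] at h
  exact h.symm

lemma im_sum_mul_eq (a n : ι → ℂ) :
    (∑ l, a l * n l).im = (∑ l, (-Complex.I * a l) * n l).re := by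
  rw [Complex.im_sum, Complex.re_sum]
  refine Finset.sum_congr rfl fun l _ => ?_
  simp

lemma memLp_sum_pi_complexGaussian {v : ℝ} (hv : 0 ≤ v) (a : ι → ℂ) :
    MemLp (fun n : ι → ℂ => ∑ l, a l * n l) 2 (Measure.pi fun _ : ι => complexGaussian v) := by
  have h1 := memLp_re_sum_pi_complexGaussian hv a
  have h2 := memLp_re_sum_pi_complexGaussian hv (fun l => -Complex.I * a l)
  simp_rw [← im_sum_mul_eq] at h2
  exact (memLp_re_im_iff (K := ℂ)).1 ⟨h1, h2⟩

lemma integral_sum_pi_complexGaussian {v : ℝ} (hv : 0 ≤ v) (a : ι → ℂ) :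
    ∫ n : ι → ℂ, (∑ l, a l * n l) ∂(Measure.pi fun _ : ι => complexGaussian v) = 0 := by
  have hi := (memLp_sum_pi_complexGaussian hv a).integrable (by norm_num)
  apply Complex.ext
  · have := integral_re hi
    simp only [RCLike.re_eq_complex_re] at this
    rw [← this, integral_re_sum_pi_complexGaussian hv]; simp
  · have := integral_im hi
    simp only [RCLike.im_eq_complex_im] at this
    rw [← this]
    simp_rw [im_sum_mul_eq]
    rw [integral_re_sum_pi_complexGaussian hv]; simp

lemma integral_norm_sum_sq_pi_complexGaussian {v : ℝ} (hv : 0 ≤ v) (a : ι → ℂ) :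
    ∫ n : ι → ℂ, ‖∑ l, a l * n l‖ ^ 2 ∂(Measure.pi fun _ : ι => complexGaussian v) =
      v * ∑ l, ‖a l‖ ^ 2 := by
  have h : ∀ n : ι → ℂ, ‖∑ l, a l * n l‖ ^ 2 =
      (∑ l, a l * n l).re ^ 2 + (∑ l, (-Complex.I * a l) * n l).re ^ 2 := by
    intro n
    rw [← im_sum_mul_eq, ← Complex.normSq_eq_norm_sq, Complex.normSq_apply]
    ring
  simp_rw [h]
  rw [integral_add (memLp_re_sum_pi_complexGaussian hv a).integrable_sq
    (memLp_re_sum_pi_complexGaussian hv _).integrable_sq, integral_re_sum_sq_pi_complexGaussian hv,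
    integral_re_sum_sq_pi_complexGaussian hv]
  simp
  ring

lemma measurePreserving_eval_unit (v : ℝ) :
    MeasurePreserving (fun n : Unit → ℂ => n ()) (Measure.pi fun _ : Unit => complexGaussian v)
      (complexGaussian v) :=
  measurePreserving_eval (fun _ : Unit => complexGaussian v) ()

lemma memLp_id_complexGaussian {v : ℝ} (hv : 0 ≤ v) :
    MemLp (fun z : ℂ => z) 2 (complexGaussian v) := by
  have h := memLp_sum_pi_complexGaussian (ι := Unit) hv (fun _ => 1)
  rw [← (measurePreserving_eval_unit v).map_eq]
  refine (memLp_map_measure_iff (by fun_prop)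
    (measurePreserving_eval_unit v).measurable.aemeasurable).2 ?_
  simpa [Function.comp_def] using h

lemma integral_norm_sq_complexGaussian {v : ℝ} (hv : 0 ≤ v) :
    ∫ z : ℂ, ‖z‖ ^ 2 ∂(complexGaussian v) = v := by
  have h := integral_norm_sum_sq_pi_complexGaussian (ι := Unit) hv (fun _ => 1)
  rw [← (measurePreserving_eval_unit v).map_eq, integral_map (measurePreserving_eval_unit v).measurable.aemeasurable (by fun_prop)]
  simpa using h

/-! ### Mutual information of a linear Gaussian observation -/

lemma lintegral_pi_prod {X : ι → Type*} [∀ i, MeasurableSpace (X i)] (μ : ∀ i, Measure (X i))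
    [∀ i, IsProbabilityMeasure (μ i)] {f : ∀ i, X i → ENNReal} (hf : ∀ i, Measurable (f i)) :
    ∫⁻ x, ∏ i, f i (x i) ∂Measure.pi μ = ∏ i, ∫⁻ x, f i x ∂μ i := by
  rw [lintegral_prod_eq_prod_lintegral_of_indepFun Finset.univ
    (fun i (x : ∀ i, X i) => f i (x i))
    (iIndepFun_pi fun i => (hf i).aemeasurable) (fun i => (hf i).comp (measurable_pi_apply i))]
  exact Finset.prod_congr rfl fun i _ => (measurePreserving_eval μ i).lintegral_comp (hf i)

lemma pi_withDensity {X : ι → Type*} [∀ i, MeasurableSpace (X i)] (μ : ∀ i, Measure (X i))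
    [∀ i, IsProbabilityMeasure (μ i)] {f : ∀ i, X i → ENNReal} (hf : ∀ i, Measurable (f i))
    [∀ i, SigmaFinite ((μ i).withDensity (f i))] :
    Measure.pi (fun i => (μ i).withDensity (f i)) =
      (Measure.pi μ).withDensity (fun x => ∏ i, f i (x i)) := by
  classical
  refine Measure.pi_eq fun s hs => ?_
  rw [withDensity_apply _ (MeasurableSet.univ_pi hs),
    ← lintegral_indicator (MeasurableSet.univ_pi hs)]
  have h : ∀ x, (Set.univ.pi s).indicator (fun x => ∏ i, f i (x i)) x =
      ∏ i, (s i).indicator (f i) (x i) := by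
    intro x
    by_cases hx : x ∈ Set.univ.pi s
    · rw [Set.indicator_of_mem hx]
      exact Finset.prod_congr rfl fun i _ => (Set.indicator_of_mem (hx i trivial) _).symm
    · rw [Set.indicator_of_notMem hx]
      simp only [Set.mem_univ_pi, not_forall] at hx
      obtain ⟨i, hi⟩ := hx
      exact (Finset.prod_eq_zero (Finset.mem_univ i) (Set.indicator_of_notMem hi _)).symm
  simp_rw [h]
  rw [lintegral_pi_prod μ fun i => (hf i).indicator (hs i)]
  exact Finset.prod_congr rfl fun i _ => by
    rw [lintegral_indicator (hs i), withDensity_apply _ (hs i)]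

lemma pi_complexGaussian_map_const_add {v : ℝ} (hv : 0 < v) (m : ι → ℂ) :
    (Measure.pi fun _ : ι => complexGaussian v).map (fun n l => m l + n l) =
      (Measure.pi fun _ : ι => complexGaussian v).withDensity (fun n => ENNReal.ofReal
        (Real.exp ((2 * (∑ l, conj (m l) * n l).re - ∑ l, ‖m l‖ ^ 2) / v))) := by
  have hp : ∀ l, IsProbabilityMeasure ((complexGaussian v).map (fun z => m l + z)) :=
    fun l => Measure.isProbabilityMeasure_map (by fun_prop)
  have hsf : ∀ l, SigmaFinite ((complexGaussian v).withDensity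
      (fun z => ENNReal.ofReal (Real.exp ((2 * (conj (m l) * z).re - ‖m l‖ ^ 2) / v)))) := by
    intro l
    rw [← complexGaussian_map_const_add hv]
    infer_instance
  rw [Measure.pi_map_pi (f := fun l z => m l + z) (fun l => by fun_prop)]
  simp_rw [complexGaussian_map_const_add hv]
  rw [pi_withDensity (fun _ : ι => complexGaussian v) (fun l => by fun_prop)]
  congr 1
  ext n
  rw [← ENNReal.ofReal_prod_of_nonneg fun _ _ => (Real.exp_pos _).le, ← Real.exp_sum,
    ← Finset.sum_div, Finset.sum_sub_distrib, ← Finset.mul_sum, Complex.re_sum]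

/-- Mutual information of a pair whose law has the density `F` with respect to a product `N × B`,
when `B` is its second marginal: the first marginal has density `G = ∫ F dB`, and the
log-likelihood ratio is `log (F / G)`. -/
lemma mutualInfo_eq_of_withDensity {X Y : Type*} [MeasurableSpace X] [MeasurableSpace Y]
    (N : Measure X) (B : Measure Y) [IsProbabilityMeasure N] [IsProbabilityMeasure B]
    (ρ : Measure (X × Y)) [IsProbabilityMeasure ρ] {F : X × Y → ℝ} {G : X → ℝ}
    (hF : Measurable F) (hFpos : ∀ p, 0 < F p) (hG : Measurable G) (hGpos : ∀ x, 0 < G x)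
    (hFG : ∀ x, ∫⁻ y, ENNReal.ofReal (F (x, y)) ∂B = ENNReal.ofReal (G x))
    (hρ : ρ = (N.prod B).withDensity (fun p => ENNReal.ofReal (F p))) (hsnd : ρ.snd = B)
    (hint : Integrable (fun p => Real.log (F p / G p.1)) ρ) :
    mutualInfo ρ = ENNReal.ofReal (∫ p, Real.log (F p / G p.1) ∂ρ) := by
  have hfst : ρ.fst = N.withDensity (fun x => ENNReal.ofReal (G x)) := by
    ext s hs
    rw [Measure.fst_apply hs, hρ, withDensity_apply _ (measurable_fst hs), withDensity_apply _ hs,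
      ← Set.prod_univ, setLIntegral_prod _ (by fun_prop)]
    simp_rw [Measure.restrict_univ, hFG]
  have hprod : ρ.fst.prod B = (N.prod B).withDensity (fun p => ENNReal.ofReal (G p.1)) := by
    have : SFinite (N.withDensity fun x => ENNReal.ofReal (G x)) := by
      rw [← hfst]; infer_instance
    rw [hfst, prod_withDensity_left (by fun_prop)]
  have hρ' : ρ = (ρ.fst.prod B).withDensity (fun p => ENNReal.ofReal (F p / G p.1)) := by
    rw [hprod, ← withDensity_mul _ (by fun_prop) (by fun_prop), hρ]
    congr 1
    ext p
    simp only [Pi.mul_apply]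
    rw [← ENNReal.ofReal_mul (hGpos _).le, mul_div_cancel₀ _ (hGpos _).ne']
  have hac : ρ ≪ ρ.fst.prod B := by
    conv_lhs => rw [hρ']
    exact withDensity_absolutelyContinuous _ _
  have hllr : llr ρ (ρ.fst.prod B) =ᵐ[ρ] fun p => Real.log (F p / G p.1) := by
    have h := Measure.rnDeriv_withDensity (ρ.fst.prod B)
      (f := fun p => ENNReal.ofReal (F p / G p.1)) (by fun_prop)
    rw [← hρ'] at h
    filter_upwards [hac.ae_le h] with p hp
    rw [llr, hp, ENNReal.toReal_ofReal (div_pos (hFpos _) (hGpos _)).le]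
  rw [mutualInfo, hsnd, InformationTheory.klDiv_of_ac_of_integrable hac
    (hint.congr hllr.symm), integral_congr_ae hllr]
  simp

/-- The mutual information between a `CN(0, α)` variable `β` and the observation `β a + n`, where
the noise `n` has independent `CN(0, v)` components, is `log (1 + α ‖a‖² / v)`. -/
lemma mutualInfo_linear_complexGaussian {α v : ℝ} (hα : 0 < α) (hv : 0 < v) (a : ι → ℂ) :
    mutualInfo (((complexGaussian α).prod (Measure.pi fun _ : ι => complexGaussian v)).map
      (fun p : ℂ × (ι → ℂ) => ((fun l => a l * p.1 + p.2 l), p.1))) =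
      ENNReal.ofReal (Real.log (1 + α * (∑ l, ‖a l‖ ^ 2) / v)) := by
  set B := complexGaussian α with hB
  set N := Measure.pi fun _ : ι => complexGaussian v with hN
  set q := ∑ l, ‖a l‖ ^ 2 with hq
  have hq0 : 0 ≤ q := by positivity
  have hD : 0 < v + α * q := by positivity
  have hT : Measurable (fun p : ℂ × (ι → ℂ) => ((fun l => a l * p.1 + p.2 l), p.1)) := by fun_prop
  set ρ := (B.prod N).map (fun p : ℂ × (ι → ℂ) => ((fun l => a l * p.1 + p.2 l), p.1)) with hρdef
  have hρprob : IsProbabilityMeasure ρ := Measure.isProbabilityMeasure_map hT.aemeasurable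
  -- `F` is the Cameron–Martin density of the joint law with respect to noise and `β` independent,
  -- and `G` its average over `β`; both depend on the observation only through `t`.
  let t : (ι → ℂ) → ℂ := fun y => ∑ l, conj (a l) * y l
  have ht : Measurable t := by fun_prop
  let F : (ι → ℂ) × ℂ → ℝ := fun p => Real.exp ((2 * (conj p.2 * t p.1).re - q * ‖p.2‖ ^ 2) / v)
  let G : (ι → ℂ) → ℝ := fun y => Real.exp (‖t y‖ ^ 2 * α / (v * (v + α * q))) * (v / (v + α * q))
  have hre : Measurable fun p : (ι → ℂ) × ℂ => (conj p.2 * t p.1).re :=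
    Complex.measurable_re.comp (by fun_prop)
  have hF : Measurable F := by fun_prop
  have hG : Measurable G := by fun_prop
  have hGpos : ∀ y, 0 < G y := fun y => by positivity
  have hsnd : ρ.snd = B := by
    rw [Measure.snd, hρdef, Measure.map_map measurable_snd hT]
    exact Measure.map_fst_prod.trans (by simp)
  have hρ : ρ = (N.prod B).withDensity (fun p => ENNReal.ofReal (F p)) := by
    refine Measure.ext_of_lintegral _ fun f hf => ?_
    rw [hρdef, lintegral_map hf hT, lintegral_prod _ (by fun_prop),
      lintegral_withDensity_eq_lintegral_mul _ (by fun_prop) hf,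
      lintegral_prod_symm' _ ((by fun_prop : Measurable fun p => ENNReal.ofReal (F p)).mul hf)]
    refine lintegral_congr fun β => ?_
    have h := pi_complexGaussian_map_const_add hv (fun l => a l * β)
    have h2 : ∫⁻ n, f ((fun l => a l * β + n l), β) ∂N =
        ∫⁻ n, f (n, β) ∂(N.map fun n l => a l * β + n l) :=
      (lintegral_map (f := fun n => f (n, β)) (by fun_prop) (by fun_prop)).symm
    rw [h2, h, lintegral_withDensity_eq_lintegral_mul _ ?_ (by fun_prop)]
    · refine lintegral_congr fun n => ?_
      simp only [Pi.mul_apply, F, t]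
      congr 4
      have e1 : ∑ l, conj (a l * β) * n l = conj β * ∑ l, conj (a l) * n l := by
        rw [Finset.mul_sum]
        exact Finset.sum_congr rfl fun l _ => by rw [map_mul]; ring
      have e2 : ∑ l, ‖a l * β‖ ^ 2 = q * ‖β‖ ^ 2 := by
        rw [hq, Finset.sum_mul]
        exact Finset.sum_congr rfl fun l _ => by rw [norm_mul, mul_pow]
      rw [e1, e2]
    · have := measurable_re_sum_mul (fun l => conj (a l * β))
      fun_prop
  -- The log-likelihood ratio along `y = β a + n`, where `t n = ∑ conj (a l) n l`.
  have hlog : ∀ p : ℂ × (ι → ℂ), Real.log (F ((fun l => a l * p.1 + p.2 l), p.1) /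
      G (fun l => a l * p.1 + p.2 l)) =
      q / (v + α * q) * ‖p.1‖ ^ 2 + 2 / (v + α * q) * (conj p.1 * t p.2).re
        - α / (v * (v + α * q)) * ‖t p.2‖ ^ 2 + Real.log (1 + α * q / v) := by
    intro p
    have e0 : t (fun l => a l * p.1 + p.2 l) = q * p.1 + t p.2 := by
      simp only [t, hq]
      push_cast
      rw [Finset.sum_mul, ← Finset.sum_add_distrib]
      refine Finset.sum_congr rfl fun l _ => ?_
      rw [← Complex.conj_mul']
      ring
    have e1 : (1 + α * q / v) = (v / (v + α * q))⁻¹ := by field_simp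
    rw [Real.log_div (Real.exp_pos _).ne' (hGpos _).ne', Real.log_mul (Real.exp_pos _).ne'
      (by positivity), Real.log_exp, Real.log_exp, e0, e1, Real.log_inv]
    have e2 : ‖(q : ℂ) * p.1 + t p.2‖ ^ 2 =
        q ^ 2 * ‖p.1‖ ^ 2 + 2 * q * (conj p.1 * t p.2).re + ‖t p.2‖ ^ 2 := by
      rw [← Complex.normSq_eq_norm_sq, ← Complex.normSq_eq_norm_sq, ← Complex.normSq_eq_norm_sq]
      simp [Complex.normSq_apply]
      ring
    have e3 : (conj p.1 * ((q : ℂ) * p.1 + t p.2)).re =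
        q * ‖p.1‖ ^ 2 + (conj p.1 * t p.2).re := by
      rw [← Complex.normSq_eq_norm_sq]
      simp [Complex.normSq_apply]
      ring
    rw [e2, e3]
    field_simp
    ring
  have hβ : Integrable (fun p : ℂ × (ι → ℂ) => ‖p.1‖ ^ 2) (B.prod N) :=
    ((memLp_id_complexGaussian hα.le).integrable_norm_pow (by norm_num)).comp_fst N
  have htL : MemLp t 2 N := memLp_sum_pi_complexGaussian hv.le _
  have hu : Integrable (fun p : ℂ × (ι → ℂ) => ‖t p.2‖ ^ 2) (B.prod N) :=
    (htL.integrable_norm_pow (by norm_num)).comp_snd B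
  have hβ1 : Integrable (fun z : ℂ => conj z) B := by
    have := ((memLp_id_complexGaussian hα.le).integrable (by norm_num))
    exact (Complex.conjCLE.toContinuousLinearMap.integrable_comp this)
  have hcross : Integrable (fun p : ℂ × (ι → ℂ) => conj p.1 * t p.2) (B.prod N) :=
    hβ1.mul_prod (htL.integrable (by norm_num))
  have hcross_re : Integrable (fun p : ℂ × (ι → ℂ) => (conj p.1 * t p.2).re) (B.prod N) :=
    hcross.re
  have hI1 : ∫ p : ℂ × (ι → ℂ), ‖p.1‖ ^ 2 ∂(B.prod N) = α := by
    rw [integral_fun_fst (f := fun z : ℂ => ‖z‖ ^ 2), integral_norm_sq_complexGaussian hα.le]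
    simp
  have hI2 : ∫ p : ℂ × (ι → ℂ), ‖t p.2‖ ^ 2 ∂(B.prod N) = v * q := by
    rw [integral_fun_snd (f := fun n => ‖t n‖ ^ 2), integral_norm_sum_sq_pi_complexGaussian hv.le]
    simp [hq]
  have hI3 : ∫ p : ℂ × (ι → ℂ), (conj p.1 * t p.2).re ∂(B.prod N) = 0 := by
    have h1 := integral_re hcross
    simp only [RCLike.re_eq_complex_re] at h1
    rw [h1, integral_prod_mul (fun z : ℂ => conj z) t, integral_sum_pi_complexGaussian hv.le]
    simp
  have hA1 := (hβ.const_mul (q / (v + α * q))).add (hcross_re.const_mul (2 / (v + α * q)))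
  have hA2 := hA1.sub (hu.const_mul (α / (v * (v + α * q))))
  have hA3 := hA2.add (integrable_const (Real.log (1 + α * q / v)))
  have hmeas : Measurable fun p : (ι → ℂ) × ℂ => Real.log (F p / G p.1) := by fun_prop
  rw [mutualInfo_eq_of_withDensity N B ρ hF (fun p => Real.exp_pos _) hG hGpos
    (fun y => lintegral_exp_complexGaussian hα hv hq0 (t y)) hρ hsnd]
  · congr 1
    rw [hρdef, integral_map hT.aemeasurable hmeas.aestronglyMeasurable]
    simp_rw [hlog]
    rw [integral_add (by exact hA2) (by fun_prop), integral_sub (by exact hA1) (hu.const_mul _),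
      integral_add (hβ.const_mul _) (hcross_re.const_mul _), integral_const_mul, integral_const_mul,
      integral_const_mul, hI1, hI2, hI3]
    simp
    field_simp
    ring
  · rw [hρdef, integrable_map_measure hmeas.aestronglyMeasurable hT.aemeasurable]
    refine hA3.congr (ae_of_all _ fun p => ?_)
    simp only [Function.comp_apply]
    rw [hlog]
    rfl

end

/-! ### The `L²` inner product as an integral -/

lemma inner_L2_eq_integral {A : Set ℝ} (f g : L2 A) :
    (inner ℂ f g : ℂ) = ∫ z in A, conj (f z) * g z := by
  rw [L2.inner_def]
  exact integral_congr_ae (ae_of_all _ fun z => by simp [RCLike.inner_apply, mul_comm])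

lemma inner_L2_toLp_right {A : Set ℝ} (f : L2 A) {g : ℝ → ℂ} (hg : MemLp g 2 (volume.restrict A)) :
    (inner ℂ f (hg.toLp g) : ℂ) = ∫ z in A, conj (f z) * g z := by
  rw [inner_L2_eq_integral]
  refine integral_congr_ae ?_
  filter_upwards [hg.coeFn_toLp] with z hz
  rw [hz]

lemma inner_L2_toLp_left {A : Set ℝ} (f : L2 A) {g : ℝ → ℂ} (hg : MemLp g 2 (volume.restrict A)) :
    (inner ℂ (hg.toLp g) f : ℂ) = ∫ z in A, conj (g z) * f z := by
  rw [inner_L2_eq_integral]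
  refine integral_congr_ae ?_
  filter_upwards [hg.coeFn_toLp] with z hz
  rw [hz]

lemma norm_sq_L2_toLp {A : Set ℝ} {g : ℝ → ℂ} (hg : MemLp g 2 (volume.restrict A)) :
    ‖hg.toLp g‖ ^ 2 = ∫ z in A, ‖g z‖ ^ 2 := by
  have h : (inner ℂ (hg.toLp g) (hg.toLp g) : ℂ) = ((∫ z in A, ‖g z‖ ^ 2 : ℝ) : ℂ) := by
    rw [inner_L2_toLp_right, ← integral_complex_ofReal]
    refine integral_congr_ae ?_
    filter_upwards [hg.coeFn_toLp] with z hz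
    rw [hz, Complex.conj_mul']
    push_cast
    rfl
  rw [inner_self_eq_norm_sq_to_K] at h
  exact Complex.ofReal_injective (by simpa using h)

namespace System

variable (S : System)

/-! ### The line-of-sight link -/

/-- The distance of the target from the array axis. -/
noncomputable def axisDist : ℝ := Real.sqrt (S.ps 0 ^ 2 + S.ps 1 ^ 2)

lemma axisDist_pos : 0 < S.axisDist := Real.sqrt_pos.2 S.ps_off_axis

lemma norm_axisPoint_sub_sq (z : ℝ) :
    ‖axisPoint z - S.ps‖ ^ 2 = S.axisDist ^ 2 + (z - S.ps 2) ^ 2 := by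
  rw [EuclideanSpace.norm_sq_eq, axisDist, Real.sq_sqrt S.ps_off_axis.le]
  simp [axisPoint, Fin.sum_univ_three]

lemma norm_axisPoint_sub_pos (z : ℝ) : 0 < ‖axisPoint z - S.ps‖ := by
  have h := S.norm_axisPoint_sub_sq z
  have := S.axisDist_pos
  by_contra! h0
  have h1 : ‖axisPoint z - S.ps‖ = 0 := le_antisymm h0 (norm_nonneg _)
  rw [h1] at h
  nlinarith [sq_nonneg (z - S.ps 2)]

lemma norm_hs_sq (z : ℝ) :
    ‖S.hs z‖ ^ 2 = 1 / (4 * Real.pi) * (1 / (S.axisDist ^ 2 + (z - S.ps 2) ^ 2)) := by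
  have h1 : ‖Complex.exp (-(Complex.I * S.k0 * ‖axisPoint z - S.ps‖))‖ = 1 := by
    rw [Complex.norm_exp]
    simp
  rw [hs, norm_div, h1, norm_mul, Complex.norm_real, Complex.norm_real, norm_norm, div_pow,
    mul_pow, norm_axisPoint_sub_sq, Real.norm_of_nonneg (Real.sqrt_nonneg _),
    Real.sq_sqrt (by positivity)]
  field_simp

lemma continuous_hs : Continuous S.hs := by
  have h : Continuous fun z : ℝ => ‖axisPoint z - S.ps‖ := by
    have h2 : (fun z : ℝ => ‖axisPoint z - S.ps‖) =
        fun z => Real.sqrt (S.axisDist ^ 2 + (z - S.ps 2) ^ 2) := by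
      ext z
      rw [← norm_axisPoint_sub_sq, Real.sqrt_sq (norm_nonneg _)]
    rw [h2]
    fun_prop
  have h3 : ∀ z, (Real.sqrt (4 * Real.pi) * ‖axisPoint z - S.ps‖ : ℂ) ≠ 0 := by
    intro z
    have := S.norm_axisPoint_sub_pos z
    have h4 : 0 < Real.sqrt (4 * Real.pi) := Real.sqrt_pos.2 (by positivity)
    exact_mod_cast (mul_pos h4 this).ne'
  unfold hs
  exact Continuous.div (by fun_prop) (by fun_prop) h3

lemma memLp_hs (a b : ℝ) : MemLp S.hs 2 (volume.restrict (Set.Icc a b)) := by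
  obtain ⟨C, hC⟩ := isCompact_Icc.exists_bound_of_continuousOn
    (S.continuous_hs.continuousOn (s := Set.Icc a b))
  exact MemLp.of_bound S.continuous_hs.aestronglyMeasurable C
    ((ae_restrict_iff' measurableSet_Icc).2 (ae_of_all _ hC))

lemma memLp_hs_Zr : MemLp S.hs 2 (volume.restrict S.Zr) := S.memLp_hs _ _

lemma memLp_hs_Zt : MemLp S.hs 2 (volume.restrict S.Zt) := S.memLp_hs _ _

lemma integral_norm_hs_sq {a b : ℝ} (hab : a ≤ b) :
    ∫ z in Set.Icc a b, ‖S.hs z‖ ^ 2 = S.viewAngle a b / (4 * Real.pi * S.axisDist) := by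
  have hρ := S.axisDist_pos
  simp_rw [norm_hs_sq]
  rw [integral_const_mul, integral_Icc_eq_integral_Ioc, ← intervalIntegral.integral_of_le hab,
    intervalIntegral.integral_eq_sub_of_hasDerivAt
      (f := fun z => Real.arctan ((z - S.ps 2) / S.axisDist) / S.axisDist)]
  · rw [viewAngle, ← axisDist]
    field_simp
  · intro z _
    have h1 : HasDerivAt (fun z => (z - S.ps 2) / S.axisDist) (1 / S.axisDist) z :=
      ((hasDerivAt_id z).sub_const _).div_const _
    refine (h1.arctan.div_const S.axisDist).congr_deriv ?_
    have : 0 < S.axisDist ^ 2 + (z - S.ps 2) ^ 2 := by positivity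
    have h2 : 1 + ((z - S.ps 2) / S.axisDist) ^ 2 =
        (S.axisDist ^ 2 + (z - S.ps 2) ^ 2) / S.axisDist ^ 2 := by field_simp
    rw [h2]
    field_simp
  · refine Continuous.intervalIntegrable (Continuous.div (by fun_prop) (by fun_prop) ?_) _ _
    intro z
    positivity

lemma viewAngle_pos {a b : ℝ} (hab : a < b) : 0 < S.viewAngle a b := by
  have hρ := S.axisDist_pos
  rw [viewAngle, ← axisDist, sub_pos]
  exact Real.arctan_strictMono (by gcongr)

lemma Gr_eq : S.Gr = ∫ z in S.Zr, ‖S.hs z‖ ^ 2 := by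
  have := S.Lr_pos
  rw [Zr, S.integral_norm_hs_sq (by linarith), Gr, axisDist]

lemma Gr_pos : 0 < S.Gr := by
  have := S.Lr_pos
  have h := S.viewAngle_pos (a := -S.d / 2 - S.Lr) (b := -S.d / 2) (by linarith)
  have := S.axisDist_pos
  rw [Gr, ← axisDist]
  positivity

/-- The link to the target over the receive aperture, as an element of `L²`. -/
noncomputable def hsRx : L2 S.Zr := S.memLp_hs_Zr.toLp S.hs

/-- The link to the target over the transmit aperture, as an element of `L²`. -/
noncomputable def hsTx : L2 S.Zt := S.memLp_hs_Zt.toLp S.hs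

lemma rxGain_eq_inner (v : L2 S.Zr) : S.rxGain v = inner ℂ v S.hsRx :=
  (inner_L2_toLp_right v _).symm

lemma norm_hsRx_sq : ‖S.hsRx‖ ^ 2 = S.Gr := by
  rw [hsRx, norm_sq_L2_toLp, Gr_eq]

/-! ### The sensing rate -/

lemma γs_pos : 0 < S.γs := div_pos S.P_pos (pow_pos S.σs_pos 2)

/-- For `v = 0` the detected echo is zero and both sides vanish, the right one by `0 / 0 = 0`. -/
lemma mutualInfo_echoLaw (w : L2 S.Zt) (v : L2 S.Zr) (s : Fin S.L → ℂ) :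
    mutualInfo (S.echoLaw w v s) = ENNReal.ofReal (Real.log
      (1 + S.αs * S.γs * (∑ l, ‖s l‖ ^ 2) * ‖S.txGain w‖ ^ 2 * (‖S.rxGain v‖ ^ 2 / ‖v‖ ^ 2))) := by
  by_cases hv : v = 0
  · subst hv
    have h0 : S.rxGain 0 = 0 := by rw [rxGain_eq_inner, inner_zero_left]
    set N := Measure.pi fun _ : Fin S.L => complexGaussian (S.σs ^ 2 * ‖(0 : L2 S.Zr)‖ ^ 2)
    have h : S.echoLaw w 0 s = N.prod (complexGaussian S.αs) := by
      rw [echoLaw, h0]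
      refine Eq.trans ?_ Measure.prod_swap
      congr 1
      funext p
      simp [Prod.swap]
    rw [h, h0, mutualInfo, Measure.fst_prod, Measure.snd_prod, InformationTheory.klDiv_self]
    simp
  · have hv' : 0 < ‖v‖ := norm_pos_iff.2 hv
    have hσ := S.σs_pos
    rw [echoLaw, mutualInfo_linear_complexGaussian S.αs_pos (by positivity)
      (fun l => Real.sqrt S.P * S.rxGain v * S.txGain w * s l)]
    congr 3
    simp_rw [norm_mul, mul_pow]
    rw [← Finset.mul_sum, Complex.norm_real, Real.norm_of_nonneg (Real.sqrt_nonneg _),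
      Real.sq_sqrt S.P_pos.le, γs]
    field_simp

/-- The closed form of the sensing rate: by the Cauchy–Schwarz inequality, the best detector is
matched to the link between the target and the receive aperture. -/
lemma sensingRate_eq (κ : Measure (Fin S.L → ℂ)) [IsProbabilityMeasure κ]
    (hκ : ∀ᵐ s ∂κ, (1 / (S.L : ℝ)) * ∑ l, ‖s l‖ ^ 2 = 1) (w : L2 S.Zt) :
    S.sensingRate κ w = 1 / (S.L : ℝ) *
      (Real.log (1 + S.L * S.αs * S.γs * S.Gr * ‖S.txGain w‖ ^ 2) / Real.log 2) := by
  have hL : (0 : ℝ) < S.L := by exact_mod_cast S.L_pos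
  have hα := S.αs_pos
  have hγ := S.γs_pos
  have hG := S.Gr_pos
  have hMI : ∀ v, S.sensingMI κ w v = ENNReal.ofReal (Real.log
      (1 + S.αs * S.γs * S.L * ‖S.txGain w‖ ^ 2 * (‖S.rxGain v‖ ^ 2 / ‖v‖ ^ 2))) := by
    intro v
    have h : ∀ᵐ s ∂κ, mutualInfo (S.echoLaw w v s) = ENNReal.ofReal (Real.log
        (1 + S.αs * S.γs * S.L * ‖S.txGain w‖ ^ 2 * (‖S.rxGain v‖ ^ 2 / ‖v‖ ^ 2))) := by
      filter_upwards [hκ] with s hs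
      have : ∑ l, ‖s l‖ ^ 2 = (S.L : ℝ) := by field_simp at hs; exact hs
      rw [mutualInfo_echoLaw, this]
    rw [sensingMI, lintegral_congr_ae h]
    simp
  have hle : ∀ v, ‖S.rxGain v‖ ^ 2 / ‖v‖ ^ 2 ≤ S.Gr := by
    intro v
    refine div_le_of_le_mul₀ (by positivity) hG.le ?_
    rw [rxGain_eq_inner, ← norm_hsRx_sq, mul_comm, ← mul_pow]
    gcongr
    exact norm_inner_le_norm _ _
  have hatt : ‖S.rxGain S.hsRx‖ ^ 2 / ‖S.hsRx‖ ^ 2 = S.Gr := by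
    rw [rxGain_eq_inner, inner_self_eq_norm_sq_to_K, norm_pow, RCLike.norm_ofReal, abs_norm,
      norm_hsRx_sq]
    field_simp
  have hsup : ⨆ v, S.sensingMI κ w v = ENNReal.ofReal (Real.log
      (1 + S.L * S.αs * S.γs * S.Gr * ‖S.txGain w‖ ^ 2)) := by
    simp_rw [hMI]
    refine le_antisymm (iSup_le fun v => ENNReal.ofReal_le_ofReal (Real.log_le_log ?_ ?_)) ?_
    · positivity
    · rw [add_le_add_iff_left]
      calc _ ≤ S.αs * S.γs * S.L * ‖S.txGain w‖ ^ 2 * S.Gr := by gcongr; exact hle v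
        _ = _ := by ring
    · refine le_iSup_of_le S.hsRx (le_of_eq ?_)
      rw [hatt]
      congr 3
      ring
  rw [sensingRate, hsup, ENNReal.toReal_ofReal]
  refine Real.log_nonneg (le_add_of_nonneg_right ?_)
  positivity

end System

/-! ### The autocorrelation of the isotropic plane-wave channel -/

/-- The junk values `√x = 0` for `x ≤ 0` and `1 / 0 = 0` make the integrand vanish for `b ≤ x²`. -/
lemma integral_one_div_sqrt_sub_sq {b : ℝ} (hb : 0 < b) :
    Integrable (fun x : ℝ => 1 / Real.sqrt (b - x ^ 2)) ∧
      ∫ x : ℝ, 1 / Real.sqrt (b - x ^ 2) = Real.pi := by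
  set a := Real.sqrt b with ha
  have ha0 : 0 < a := Real.sqrt_pos.2 hb
  have hab : a ^ 2 = b := Real.sq_sqrt hb.le
  have hzero : ∀ x ∉ Set.Ioc (-a) a, 1 / Real.sqrt (b - x ^ 2) = 0 := by
    intro x hx
    rw [Real.sqrt_eq_zero_of_nonpos, div_zero]
    rw [← hab, sub_nonpos, sq_le_sq, abs_of_pos ha0]
    by_contra! h
    exact hx ⟨(abs_lt.1 h).1, (abs_lt.1 h).2.le⟩
  have hderiv : ∀ x ∈ Set.Ioo (-a) a,
      HasDerivAt (fun x => Real.arcsin (x / a)) (1 / Real.sqrt (b - x ^ 2)) x := by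
    intro x hx
    have h1 : x / a < 1 := (div_lt_one ha0).2 hx.2
    have h2 : -1 < x / a := by rw [lt_div_iff₀ ha0]; linarith [hx.1]
    have h3 := (Real.hasDerivAt_arcsin h2.ne' h1.ne).comp x ((hasDerivAt_id x).div_const a)
    refine h3.congr_deriv ?_
    have h4 : b - x ^ 2 = a ^ 2 * (1 - (x / a) ^ 2) := by rw [← hab]; field_simp
    rw [h4, Real.sqrt_mul (by positivity), Real.sqrt_sq ha0.le]
    rw [one_div_mul_one_div, mul_comm]
  have hcont : ContinuousOn (fun x => Real.arcsin (x / a)) (Set.Icc (-a) a) :=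
    (Real.continuous_arcsin.comp (by fun_prop)).continuousOn
  have hint : IntegrableOn (fun x : ℝ => 1 / Real.sqrt (b - x ^ 2)) (Set.Ioc (-a) a) :=
    intervalIntegral.integrableOn_deriv_of_nonneg hcont hderiv (fun x _ => by positivity)
  refine ⟨(integrableOn_iff_integrable_of_support_subset ?_).1 hint, ?_⟩
  · intro x hx
    by_contra h
    exact hx (hzero x h)
  · rw [← setIntegral_eq_integral_of_forall_compl_eq_zero hzero,
      ← intervalIntegral.integral_of_le (by linarith),
      intervalIntegral.integral_eq_sub_of_hasDerivAt_of_le (by linarith) hcont hderiv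
        ((intervalIntegrable_iff_integrableOn_Ioc_of_le (by linarith)).2 hint)]
    rw [div_self ha0.ne', neg_div, div_self ha0.ne', Real.arcsin_one, Real.arcsin_neg_one]
    ring

lemma one_div_sqrt_sub_sq_of_nonpos {b : ℝ} (hb : b ≤ 0) (x : ℝ) :
    1 / Real.sqrt (b - x ^ 2) = 0 := by
  rw [Real.sqrt_eq_zero_of_nonpos (by nlinarith [sq_nonneg x]), div_zero]

namespace System

variable (S : System)

lemma k0_pos : 0 < S.k0 := div_pos (by positivity) S.wavelength_pos

lemma one_div_waveY_eq_zero {κ : ℝ × ℝ} (h : κ ∉ S.waveDisk) : 1 / S.waveY κ = 0 := by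
  rw [waveDisk, Set.mem_ofPred_eq, not_le] at h
  rw [waveY, Real.sqrt_eq_zero_of_nonpos (by linarith), div_zero]

lemma integral_one_div_waveY_left (y : ℝ) :
    ∫ x : ℝ, 1 / S.waveY (x, y) = (Set.Ioo (-S.k0) S.k0).indicator (fun _ => Real.pi) y := by
  have hk := S.k0_pos
  have e : ∀ x, S.waveY (x, y) = Real.sqrt ((S.k0 ^ 2 - y ^ 2) - x ^ 2) := by
    intro x; rw [waveY]; congr 1; ring
  simp_rw [e]
  by_cases hy : y ∈ Set.Ioo (-S.k0) S.k0
  · rw [Set.indicator_of_mem hy]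
    refine (integral_one_div_sqrt_sub_sq ?_).2
    nlinarith [hy.1, hy.2]
  · rw [Set.indicator_of_notMem hy]
    have : S.k0 ^ 2 - y ^ 2 ≤ 0 := by
      rw [sub_nonpos, sq_le_sq, abs_of_pos hk]
      by_contra! h
      exact hy (abs_lt.1 h)
    simp_rw [one_div_sqrt_sub_sq_of_nonpos this]
    simp

lemma integrable_one_div_waveY_left (y : ℝ) : Integrable fun x : ℝ => 1 / S.waveY (x, y) := by
  have e : ∀ x, S.waveY (x, y) = Real.sqrt ((S.k0 ^ 2 - y ^ 2) - x ^ 2) := by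
    intro x; rw [waveY]; congr 1; ring
  simp_rw [e]
  rcases le_or_gt (S.k0 ^ 2 - y ^ 2) 0 with h | h
  · simp_rw [one_div_sqrt_sub_sq_of_nonpos h]
    exact integrable_zero _ _ _
  · exact (integral_one_div_sqrt_sub_sq h).1

/-- Integrating the `x`-component out: the `z`-components of isotropic waves are uniformly
distributed (Archimedes' hat-box theorem). -/
lemma integral_waveDisk (u : ℝ) :
    ∫ κ in S.waveDisk, ((1 / S.waveY κ : ℝ) : ℂ) * Complex.exp (Complex.I * (κ.2 * u : ℝ)) =
      ((2 * Real.pi * S.k0 * Real.sinc (S.k0 * u) : ℝ) : ℂ) := by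
  have hk := S.k0_pos
  let H : ℝ × ℝ → ℂ := fun κ => ((1 / S.waveY κ : ℝ) : ℂ) * Complex.exp (Complex.I * (κ.2 * u : ℝ))
  have hHm : Measurable H := by
    have : Measurable S.waveY := by unfold waveY; fun_prop
    fun_prop
  have hnorm : ∀ κ, ‖H κ‖ = 1 / S.waveY κ := by
    intro κ
    have h0 : 0 ≤ 1 / S.waveY κ := by unfold waveY; positivity
    simp only [H]
    rw [norm_mul, mul_comm Complex.I, Complex.norm_exp_ofReal_mul_I, mul_one, Complex.norm_real,
      Real.norm_of_nonneg h0]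
  have hHi : Integrable H (volume.prod volume) := by
    rw [integrable_prod_iff' hHm.aestronglyMeasurable]
    refine ⟨ae_of_all _ fun y => ?_, ?_⟩
    · refine (S.integrable_one_div_waveY_left y).mono'
        (hHm.comp (by fun_prop)).aestronglyMeasurable (ae_of_all _ fun x => ?_)
      rw [hnorm]
    · simp_rw [hnorm, integral_one_div_waveY_left]
      exact (integrable_indicator_iff measurableSet_Ioo).2 (integrableOn_const (by simp))
  have h1 : ∫ κ in S.waveDisk, H κ = ∫ κ, H κ := by
    refine setIntegral_eq_integral_of_forall_compl_eq_zero fun κ hκ => ?_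
    simp only [H]
    rw [S.one_div_waveY_eq_zero hκ]
    simp
  have h2 : ∀ y, ∫ x, H (x, y) =
      (Set.Ioo (-S.k0) S.k0).indicator (fun y => Real.pi * Complex.exp (Complex.I * (y * u : ℝ))) y := by
    intro y
    simp only [H]
    rw [integral_mul_const, integral_complex_ofReal, integral_one_div_waveY_left]
    by_cases hy : y ∈ Set.Ioo (-S.k0) S.k0
    · rw [Set.indicator_of_mem hy, Set.indicator_of_mem hy]
    · rw [Set.indicator_of_notMem hy, Set.indicator_of_notMem hy]; simp
  change ∫ κ in S.waveDisk, H κ = _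
  rw [h1, Measure.volume_eq_prod, integral_prod_symm _ hHi]
  simp_rw [h2]
  rw [integral_indicator measurableSet_Ioo, ← integral_Ioc_eq_integral_Ioo,
    ← intervalIntegral.integral_of_le (by linarith), intervalIntegral.integral_const_mul]
  by_cases hu : u = 0
  · subst hu
    simp
    ring
  · have hc : Complex.I * (u : ℂ) ≠ 0 := by simp [hu]
    have h3 : ∀ y : ℝ, Complex.exp (Complex.I * (y * u : ℝ)) = Complex.exp (Complex.I * u * y) := by
      intro y; congr 1; push_cast; ring
    simp_rw [h3]
    rw [integral_exp_mul_complex hc, Real.sinc_of_ne_zero (mul_ne_zero hk.ne' hu)]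
    push_cast
    rw [Complex.sin]
    have h4 : (S.k0 : ℂ) ≠ 0 := by exact_mod_cast hk.ne'
    have h5 : (u : ℂ) ≠ 0 := by exact_mod_cast hu
    have h6 : Complex.I * u * S.k0 = (S.k0 * u) * Complex.I := by ring
    have h7 : Complex.I * u * -S.k0 = -(S.k0 * u) * Complex.I := by ring
    rw [h6, h7]
    field_simp
    rw [Complex.I_sq]
    ring

/-- The user-side phases cancel, the user-side integral is a constant, and the aperture-side
integral is the Fourier transform of the uniform law on `[-k₀, k₀]`. -/
lemma channelCorr_eq (z z' : ℝ) : S.channelCorr z z' = S.sincKernel z z' := by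
  have hk := S.k0_pos
  set C : ℝ := (1 / (2 * Real.pi) ^ 2) ^ 2 * (2 * Real.pi / S.k0) ^ 2 with hC
  have h1 : ∀ k κ, S.planeWave z k κ * conj (S.planeWave z' k κ) =
      ((C * (1 / S.waveY k) : ℝ) : ℂ) *
        (((1 / S.waveY κ : ℝ) : ℂ) * Complex.exp (Complex.I * (κ.2 * (z - z') : ℝ))) := by
    intro k κ
    have hi : ∀ z, inner ℝ (S.waveVec κ) (axisPoint z) = κ.2 * z := by
      intro z
      simp [waveVec, axisPoint, PiLp.inner_apply, Fin.sum_univ_three, mul_comm]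
    have hY : ∀ k, 0 ≤ S.waveY k := fun k => Real.sqrt_nonneg _
    have hs : (Real.sqrt (S.waveY k * S.waveY κ)) * (Real.sqrt (S.waveY k * S.waveY κ)) =
        S.waveY k * S.waveY κ := Real.mul_self_sqrt (mul_nonneg (hY _) (hY _))
    have he : Complex.exp (-(Complex.I * (inner ℝ (S.waveVec k) S.pc : ℝ))) *
        Complex.exp (Complex.I * (inner ℝ (S.waveVec k) S.pc : ℝ)) = 1 := by
      rw [← Complex.exp_add]; simp
    have he2 : Complex.exp (Complex.I * (κ.2 * z : ℝ)) * Complex.exp (-(Complex.I * (κ.2 * z' : ℝ))) =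
        Complex.exp (Complex.I * (κ.2 * (z - z') : ℝ)) := by
      rw [← Complex.exp_add]; congr 1; push_cast; ring
    have hC2 : ((C * (1 / S.waveY k) : ℝ) : ℂ) * ((1 / S.waveY κ : ℝ) : ℂ) =
        ((1 / (2 * Real.pi) ^ 2 : ℝ) * ((2 * Real.pi / S.k0) / Real.sqrt (S.waveY k * S.waveY κ) : ℝ))
        * ((1 / (2 * Real.pi) ^ 2 : ℝ) *
          ((2 * Real.pi / S.k0) / Real.sqrt (S.waveY k * S.waveY κ) : ℝ)) := by
      rw [← Complex.ofReal_mul, ← Complex.ofReal_mul, ← Complex.ofReal_mul]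
      congr 1
      calc _ = (1 / (2 * Real.pi) ^ 2) ^ 2 * (2 * Real.pi / S.k0) ^ 2 *
            (S.waveY k * S.waveY κ)⁻¹ := by rw [hC, mul_inv]; ring
        _ = _ := by
          have hinv : (S.waveY k * S.waveY κ)⁻¹ = (Real.sqrt (S.waveY k * S.waveY κ))⁻¹ *
              (Real.sqrt (S.waveY k * S.waveY κ))⁻¹ := by rw [← mul_inv, hs]
          rw [hinv]
          generalize Real.sqrt (S.waveY k * S.waveY κ) = r
          ring
    rw [planeWave, planeWave, hi, hi, map_mul, map_mul, map_mul, ← Complex.exp_conj,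
      ← Complex.exp_conj, Complex.conj_ofReal, Complex.conj_ofReal, map_neg, map_mul, map_mul,
      Complex.conj_I, Complex.conj_ofReal, Complex.conj_ofReal, neg_mul, neg_neg, neg_mul]
    linear_combination (((1 / (2 * Real.pi) ^ 2 : ℝ) : ℂ) *
      ((2 * Real.pi / S.k0) / Real.sqrt (S.waveY k * S.waveY κ) : ℝ)) ^ 2 *
      Complex.exp (Complex.I * (κ.2 * z : ℝ)) * Complex.exp (-(Complex.I * (κ.2 * z' : ℝ))) * he +
      (((1 / (2 * Real.pi) ^ 2 : ℝ) : ℂ) *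
      ((2 * Real.pi / S.k0) / Real.sqrt (S.waveY k * S.waveY κ) : ℝ)) ^ 2 * he2 -
      Complex.exp (Complex.I * (κ.2 * (z - z') : ℝ)) * hC2
  have h2 := S.integral_waveDisk 0
  simp only [mul_zero, Complex.ofReal_zero, Complex.exp_zero, mul_one, Real.sinc_zero] at h2
  rw [channelCorr]
  simp_rw [h1, integral_const_mul, S.integral_waveDisk (z - z'), integral_mul_const,
    Complex.ofReal_mul C, integral_const_mul]
  rw [h2, sincKernel, ← Complex.ofReal_mul, ← Complex.ofReal_mul]
  congr 1
  rw [hC]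
  field_simp

end System

/-! ### The sinc kernel has infinite rank -/

lemma integral_Icc_swap {a b c d : ℝ} {h : ℝ × ℝ → ℂ} (hh : Continuous h) :
    ∫ x in Set.Icc a b, ∫ y in Set.Icc c d, h (x, y) =
      ∫ y in Set.Icc c d, ∫ x in Set.Icc a b, h (x, y) := by
  refine integral_integral_swap (f := fun x y => h (x, y)) ?_
  rw [Measure.prod_restrict]
  exact (hh.continuousOn.integrableOn_compact (isCompact_Icc.prod isCompact_Icc))

lemma continuous_setIntegral_Icc {a b : ℝ} {h : ℝ × ℝ → ℂ} (hh : Continuous h) :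
    Continuous fun x => ∫ y in Set.Icc a b, h (x, y) :=
  continuous_parametric_integral_of_continuous (f := fun x y => h (x, y)) hh isCompact_Icc

lemma eqOn_zero_of_setIntegral_norm_sq_eq_zero {a b : ℝ} (hab : a < b) {g : ℝ → ℂ}
    (hg : Continuous g) (h : ∫ x in Set.Icc a b, ‖g x‖ ^ 2 = 0) : ∀ x ∈ Set.Icc a b, g x = 0 := by
  rw [setIntegral_eq_zero_iff_of_nonneg_ae (ae_of_all _ fun x => by positivity)
    ((by fun_prop : Continuous fun x => ‖g x‖ ^ 2).continuousOn.integrableOn_compact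
      isCompact_Icc)] at h
  have h2 : g =ᵐ[volume.restrict (Set.Icc a b)] fun _ => 0 := by
    filter_upwards [h] with x hx
    simpa using hx
  exact Measure.eqOn_Icc_of_ae_eq volume hab.ne h2 hg.continuousOn continuousOn_const

/-- If the Fourier transform of a compactly supported function vanishes near the origin, then so do
all the moments of the function. -/
lemma setIntegral_mul_pow_eq_zero {a b K : ℝ} (hK : 0 < K) {f : ℝ → ℂ} (hf : Continuous f)
    (h : ∀ k ∈ Set.Ioo (-K) K, ∫ z in Set.Icc a b, f z * Complex.exp (-(Complex.I * k * z)) = 0)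
    (j : ℕ) : ∫ z in Set.Icc a b, f z * (z : ℂ) ^ j = 0 := by
  have key : ∀ j : ℕ, ∀ k ∈ Set.Ioo (-K) K,
      ∫ z in Set.Icc a b, f z * (z : ℂ) ^ j * Complex.exp (-(Complex.I * k * z)) = 0 := by
    intro j
    induction j with
    | zero => simpa using h
    | succ j ih =>
      intro k hk
      obtain ⟨C, hC⟩ := isCompact_Icc.exists_bound_of_continuousOn
        ((by fun_prop : Continuous fun z : ℝ => f z * (z : ℂ) ^ (j + 1)).continuousOn
          (s := Set.Icc a b))
      have hd := hasDerivAt_integral_of_dominated_loc_of_deriv_le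
        (μ := volume.restrict (Set.Icc a b))
        (F := fun (k : ℝ) (z : ℝ) => f z * (z : ℂ) ^ j * Complex.exp (-(Complex.I * k * z)))
        (F' := fun (k : ℝ) (z : ℝ) => -Complex.I *
          (f z * (z : ℂ) ^ (j + 1) * Complex.exp (-(Complex.I * k * z))))
        (bound := fun _ => C) (s := Set.univ) (x₀ := k) Filter.univ_mem
        (Filter.Eventually.of_forall fun k => by fun_prop)
        ((by fun_prop : Continuous fun z : ℝ => f z * (z : ℂ) ^ j *
          Complex.exp (-(Complex.I * k * z))).continuousOn.integrableOn_compact isCompact_Icc)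
        (by fun_prop) ?_ (integrable_const C) ?_
      · have h0 : HasDerivAt (fun k : ℝ => ∫ z in Set.Icc a b,
            f z * (z : ℂ) ^ j * Complex.exp (-(Complex.I * k * z))) 0 k := by
          refine (hasDerivAt_const k (0 : ℂ)).congr_of_eventuallyEq ?_
          filter_upwards [isOpen_Ioo.mem_nhds hk] with x hx
          exact ih x hx
        have := hd.2.unique h0
        rw [integral_const_mul] at this
        simpa using this
      · refine (ae_restrict_iff' measurableSet_Icc).2 (ae_of_all _ fun z hz x _ => ?_)
        have he : ‖Complex.exp (-(Complex.I * x * z))‖ = 1 := by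
          rw [Complex.norm_exp]; simp
        rw [norm_mul, norm_neg, Complex.norm_I, one_mul, norm_mul, he, mul_one]
        exact hC z hz
      · refine ae_of_all _ fun z x _ => ?_
        have h1 : HasDerivAt (fun x : ℝ => -(Complex.I * x * z)) (-(Complex.I * z)) x := by
          have := (((Complex.ofRealCLM.hasDerivAt (x := x)).const_mul Complex.I).mul_const
            (z : ℂ)).neg
          exact this.congr_deriv (by simp)
        refine (h1.cexp.const_mul (f z * (z : ℂ) ^ j)).congr_deriv ?_
        ring
  have := key j 0 ⟨by linarith, hK⟩
  simpa using this

namespace System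

variable (S : System)

lemma sinc_eq_integral (u : ℝ) :
    ((Real.sinc (S.k0 * u) : ℝ) : ℂ) = (1 / (2 * S.k0) : ℝ) *
      ∫ k in Set.Icc (-S.k0) S.k0, Complex.exp (Complex.I * k * u) := by
  have hk := S.k0_pos
  rw [integral_Icc_eq_integral_Ioc, ← intervalIntegral.integral_of_le (by linarith)]
  by_cases hu : u = 0
  · subst hu
    have : (S.k0 : ℂ) ≠ 0 := by exact_mod_cast hk.ne'
    simp
    field_simp
    ring
  · have hc : Complex.I * (u : ℂ) ≠ 0 := by simp [hu]
    have h3 : ∀ y : ℝ, Complex.exp (Complex.I * y * u) = Complex.exp (Complex.I * u * y) := by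
      intro y; congr 1; ring
    simp_rw [h3]
    rw [integral_exp_mul_complex hc, Real.sinc_of_ne_zero (mul_ne_zero hk.ne' hu)]
    push_cast
    rw [Complex.sin]
    have h4 : (S.k0 : ℂ) ≠ 0 := by exact_mod_cast hk.ne'
    have h5 : (u : ℂ) ≠ 0 := by exact_mod_cast hu
    have h6 : Complex.I * u * S.k0 = (S.k0 * u) * Complex.I := by ring
    have h7 : Complex.I * u * -S.k0 = -(S.k0 * u) * Complex.I := by ring
    rw [h6, h7]
    field_simp
    rw [Complex.I_sq]
    ring

lemma memLp_of_continuous {f : ℝ → ℂ} (hf : Continuous f) :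
    MemLp f 2 (volume.restrict S.Zt) := by
  obtain ⟨C, hC⟩ := isCompact_Icc.exists_bound_of_continuousOn (hf.continuousOn (s := S.Zt))
  have : IsFiniteMeasure (volume.restrict S.Zt) := by unfold Zt; infer_instance
  exact MemLp.of_bound hf.aestronglyMeasurable C
    ((ae_restrict_iff' measurableSet_Icc).2 (ae_of_all _ hC))

/-- The quadratic form of the sinc kernel is the energy of the Fourier transform in the band
`[-k₀, k₀]`. -/
lemma kernelForm_sincKernel {f : ℝ → ℂ} (hf : Continuous f) :
    kernelForm S.Zt S.sincKernel ((S.memLp_of_continuous hf).toLp f)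
      ((S.memLp_of_continuous hf).toLp f) =
      ((1 / (2 * S.k0) * ∫ k in Set.Icc (-S.k0) S.k0,
        ‖∫ z in S.Zt, f z * Complex.exp (-(Complex.I * k * z))‖ ^ 2 : ℝ) : ℂ) := by
  have hae := (S.memLp_of_continuous hf).coeFn_toLp
  set F : ℝ → ℂ := fun k => ∫ z in S.Zt, f z * Complex.exp (-(Complex.I * k * z)) with hF
  have hFc : Continuous F := continuous_setIntegral_Icc
    (h := fun p => f p.2 * Complex.exp (-(Complex.I * p.1 * p.2))) (by fun_prop)
  have h1 : ∀ z, ∫ z' in S.Zt, conj (f z) * S.sincKernel z z' * f z' =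
      (1 / (2 * S.k0) : ℝ) * ∫ k in Set.Icc (-S.k0) S.k0,
        conj (f z) * Complex.exp (Complex.I * k * z) * F k := by
    intro z
    have h2 : ∀ z', conj (f z) * S.sincKernel z z' * f z' = (1 / (2 * S.k0) : ℝ) *
        ∫ k in Set.Icc (-S.k0) S.k0, conj (f z) * Complex.exp (Complex.I * k * z) *
          (f z' * Complex.exp (-(Complex.I * k * z'))) := by
      intro z'
      rw [sincKernel, sinc_eq_integral, mul_left_comm, mul_assoc, ← integral_const_mul,
        ← integral_mul_const]
      congr 1
      refine integral_congr_ae (ae_of_all _ fun k => ?_)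
      have : Complex.exp (Complex.I * k * (z - z' : ℝ)) =
          Complex.exp (Complex.I * k * z) * Complex.exp (-(Complex.I * k * z')) := by
        rw [← Complex.exp_add]; congr 1; push_cast; ring
      simp only [this]
      ring
    simp_rw [h2]
    rw [integral_const_mul]
    congr 1
    rw [Zt, integral_Icc_swap (h := fun p => conj (f z) * Complex.exp (Complex.I * p.2 * z) *
          (f p.1 * Complex.exp (-(Complex.I * p.2 * p.1)))) (by fun_prop)]
    simp_rw [integral_const_mul]
    rfl
  have h3 : kernelForm S.Zt S.sincKernel ((S.memLp_of_continuous hf).toLp f)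
      ((S.memLp_of_continuous hf).toLp f) =
      ∫ z in S.Zt, ∫ z' in S.Zt, conj (f z) * S.sincKernel z z' * f z' := by
    refine integral_congr_ae ?_
    filter_upwards [hae] with z hz
    refine integral_congr_ae ?_
    filter_upwards [hae] with z' hz'
    rw [hz, hz']
  have hconj : Continuous fun z => conj (f z) := Complex.continuous_conj.comp hf
  rw [h3]
  simp_rw [h1]
  rw [integral_const_mul, Zt, integral_Icc_swap (h := fun p => conj (f p.1) *
    Complex.exp (Complex.I * p.2 * p.1) * F p.2) (by fun_prop), Complex.ofReal_mul]
  congr 1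
  rw [← integral_complex_ofReal]
  refine integral_congr_ae (ae_of_all _ fun k => ?_)
  change ∫ z in S.Zt, conj (f z) * Complex.exp (Complex.I * k * z) * F k = ((‖F k‖ ^ 2 : ℝ) : ℂ)
  rw [integral_mul_const, Complex.ofReal_pow, ← Complex.conj_mul']
  congr 1
  simp only [hF]
  rw [← integral_conj]
  refine integral_congr_ae (ae_of_all _ fun z => ?_)
  simp [← Complex.exp_conj]

/-- The sinc kernel has infinite rank: all its eigenvalues are positive. Otherwise its form would
vanish at a nonzero polynomial, whose Fourier transform would vanish on a band. -/
lemma lam_pos {lam : ℕ → ℝ} {φ : ℕ → L2 S.Zt} (h : IsKernelEVD S.Zt S.sincKernel lam φ) (N : ℕ) :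
    0 < lam N := by
  have hk := S.k0_pos
  have hLt := S.Lt_pos
  rcases (h.nonneg N).lt_or_eq with h0 | h0
  · exact h0
  exfalso
  have hzero : ∀ n, N ≤ n → lam n = 0 := fun n hn =>
    le_antisymm ((h.antitone hn).trans h0.symm.le) (h.nonneg n)
  -- A nonzero polynomial `f` of degree at most `N` is orthogonal to the first `N` eigenvectors.
  let e : Fin (N + 1) → L2 S.Zt := fun j =>
    (S.memLp_of_continuous (f := fun z => (z : ℂ) ^ (j : ℕ)) (by fun_prop)).toLp _
  let T : (Fin (N + 1) → ℂ) →ₗ[ℂ] (Fin N → ℂ) :=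
    { toFun := fun c n => ∑ j, c j * inner ℂ (φ n) (e j)
      map_add' := by
        intro c c'; ext n
        simp [add_mul, Finset.sum_add_distrib]
      map_smul' := by
        intro r c; ext n
        simp [Finset.mul_sum, mul_assoc] }
  obtain ⟨c, hcT, hc0⟩ := (Submodule.ne_bot_iff _).1
    (T.ker_ne_bot_of_finrank_lt (by simp))
  let f : ℝ → ℂ := fun z => ∑ j, c j * (z : ℂ) ^ (j : ℕ)
  have hf : Continuous f := by fun_prop
  have horth : ∀ n < N, inner ℂ (φ n) ((S.memLp_of_continuous hf).toLp f) = (0 : ℂ) := by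
    intro n hn
    have h1 : ∀ z, conj (φ n z) * f z = ∑ j, c j * (conj (φ n z) * (z : ℂ) ^ (j : ℕ)) := by
      intro z
      simp only [f]
      rw [Finset.mul_sum]
      exact Finset.sum_congr rfl fun j _ => by ring
    have h2 : ∀ j : Fin (N + 1), Integrable (fun z : ℝ => conj (φ n z) * (z : ℂ) ^ (j : ℕ))
        (volume.restrict S.Zt) := fun j =>
      (Lp.memLp (φ n)).star.integrable_mul (S.memLp_of_continuous (by fun_prop))
    have h3 := congrFun (LinearMap.mem_ker.1 hcT) ⟨n, hn⟩
    rw [inner_L2_toLp_right]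
    simp_rw [h1]
    rw [integral_finsetSum _ fun j _ => (h2 j).const_mul _]
    simp_rw [integral_const_mul]
    refine Eq.trans (Finset.sum_congr rfl fun j _ => ?_) h3
    rw [inner_L2_toLp_right]
  have hform : kernelForm S.Zt S.sincKernel ((S.memLp_of_continuous hf).toLp f)
      ((S.memLp_of_continuous hf).toLp f) = 0 := by
    refine (h.expansion _ _).unique ?_
    convert hasSum_zero using 2 with n
    rcases lt_or_ge n N with hn | hn
    · rw [horth n hn, mul_zero]
    · rw [hzero n hn]; simp
  rw [S.kernelForm_sincKernel hf, Complex.ofReal_eq_zero, mul_eq_zero,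
    or_iff_right (by positivity)] at hform
  have hFc : Continuous fun k : ℝ => ∫ z in S.Zt, f z * Complex.exp (-(Complex.I * k * z)) :=
    continuous_setIntegral_Icc
      (h := fun p => f p.2 * Complex.exp (-(Complex.I * p.1 * p.2))) (by fun_prop)
  have hband := eqOn_zero_of_setIntegral_norm_sq_eq_zero (by linarith) hFc hform
  have hmom := setIntegral_mul_pow_eq_zero hk hf (fun k hk => hband k (Set.Ioo_subset_Icc_self hk))
  -- `∫ |f|²` is a combination of moments of `f`, because `f` is a polynomial.
  have hnorm : ∫ z in S.Zt, ‖f z‖ ^ 2 = 0 := by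
    have h1 : ∀ z, ((‖f z‖ ^ 2 : ℝ) : ℂ) = ∑ j, conj (c j) * (f z * (z : ℂ) ^ (j : ℕ)) := by
      intro z
      have : conj (f z) = ∑ j, conj (c j) * (z : ℂ) ^ (j : ℕ) := by
        simp only [f]
        rw [map_sum]
        simp
      rw [Complex.ofReal_pow, ← Complex.conj_mul', this, Finset.sum_mul]
      exact Finset.sum_congr rfl fun j _ => by ring
    apply Complex.ofReal_injective
    rw [← integral_complex_ofReal]
    simp_rw [h1]
    rw [integral_finsetSum _ fun j _ => ?_]
    · simp_rw [integral_const_mul]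
      simp [Zt, hmom]
    · exact (by fun_prop : Continuous fun z : ℝ => conj (c j) *
        (f z * (z : ℂ) ^ (j : ℕ))).continuousOn.integrableOn_compact isCompact_Icc
  have hfz := eqOn_zero_of_setIntegral_norm_sq_eq_zero (by linarith) hf hnorm
  let p : Polynomial ℂ := ∑ j : Fin (N + 1), Polynomial.C (c j) * Polynomial.X ^ (j : ℕ)
  have hp : p = 0 := by
    refine Polynomial.eq_zero_of_infinite_isRoot p ?_
    refine Set.Infinite.mono (s := Complex.ofReal '' S.Zt) ?_
      ((Set.Icc_infinite (by linarith)).image Complex.ofReal_injective.injOn)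
    rintro _ ⟨z, hz, rfl⟩
    have := hfz z hz
    simpa [p, Polynomial.IsRoot, Polynomial.eval_finsetSum, f] using this
  refine hc0 (funext fun j => ?_)
  have := congrArg (fun q => Polynomial.coeff q j) hp
  simpa [p, Polynomial.finsetSum_coeff, Polynomial.coeff_X_pow, Fin.val_inj] using this

end System

/-! ### Kernels of finite rank -/

lemma integrable_conj_mul {A : Set ℝ} (u v : L2 A) :
    Integrable (fun z => conj (u z) * v z) (volume.restrict A) :=
  (Lp.memLp u).star.integrable_mul (Lp.memLp v)

lemma kernelForm_sum {A : Set ℝ} {ι : Type*} (s : Finset ι) (C : ι → ℂ) (a b : ι → L2 A)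
    (f g : L2 A) :
    kernelForm A (fun z z' => ∑ i ∈ s, C i * a i z * conj (b i z')) f g =
      ∑ i ∈ s, C i * inner ℂ f (a i) * inner ℂ (b i) g := by
  have h1 : ∀ z, ∫ z' in A, conj (f z) * (∑ i ∈ s, C i * a i z * conj (b i z')) * g z' =
      ∑ i ∈ s, conj (f z) * a i z * (C i * inner ℂ (b i) g) := by
    intro z
    have h2 : ∀ z', conj (f z) * (∑ i ∈ s, C i * a i z * conj (b i z')) * g z' =
        ∑ i ∈ s, conj (f z) * a i z * C i * (conj (b i z') * g z') := by
      intro z'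
      rw [Finset.mul_sum, Finset.sum_mul]
      exact Finset.sum_congr rfl fun i _ => by ring
    simp_rw [h2]
    rw [integral_finsetSum _ fun i _ => (integrable_conj_mul _ _).const_mul _]
    refine Finset.sum_congr rfl fun i _ => ?_
    rw [integral_const_mul, inner_L2_eq_integral]
    ring
  rw [kernelForm]
  simp_rw [h1]
  rw [integral_finsetSum _ fun i _ => (integrable_conj_mul _ _).mul_const _]
  refine Finset.sum_congr rfl fun i _ => ?_
  rw [integral_mul_const, inner_L2_eq_integral f]
  ring

namespace System

variable (S : System)

/-- The sensing gain `L α_s γ_s G_r` multiplying `h_s h_s^*` in the kernel `Q`. -/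
noncomputable def sensingGain : ℝ := (S.L : ℝ) * S.αs * S.γs * S.Gr

lemma sensingGain_pos : 0 < S.sensingGain := by
  have hL : (0 : ℝ) < S.L := by exact_mod_cast S.L_pos
  have := S.αs_pos
  have := S.γs_pos
  have := S.Gr_pos
  unfold sensingGain
  positivity

variable {S} {lam : ℕ → ℝ} {φ : ℕ → L2 S.Zt}

lemma integral_sqrtKernel_mul (N : ℕ) (z : ℝ) (g : L2 S.Zt) :
    ∫ z' in S.Zt, S.sqrtKernel lam φ N z z' * g z' =
      ∑ n ∈ Finset.range N, (Real.sqrt (lam n) : ℂ) * φ n z * inner ℂ (φ n) g := by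
  have h : ∀ z', S.sqrtKernel lam φ N z z' * g z' =
      ∑ n ∈ Finset.range N, (Real.sqrt (lam n) : ℂ) * φ n z * (conj (φ n z') * g z') := by
    intro z'
    rw [sqrtKernel, Finset.sum_mul]
    exact Finset.sum_congr rfl fun n _ => by ring
  simp_rw [h]
  rw [integral_finsetSum _ fun n _ => (integrable_conj_mul (φ n) g).const_mul _]
  simp_rw [integral_const_mul, inner_L2_eq_integral]

lemma integral_mul_sqrtKernel (N : ℕ) (z : ℝ) (g : L2 S.Zt) :
    ∫ z' in S.Zt, conj (g z') * S.sqrtKernel lam φ N z' z =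
      ∑ n ∈ Finset.range N, (Real.sqrt (lam n) : ℂ) * inner ℂ g (φ n) * conj (φ n z) := by
  have h : ∀ z', conj (g z') * S.sqrtKernel lam φ N z' z =
      ∑ n ∈ Finset.range N, (Real.sqrt (lam n) : ℂ) * conj (φ n z) * (conj (g z') * φ n z') := by
    intro z'
    rw [sqrtKernel, Finset.mul_sum]
    exact Finset.sum_congr rfl fun n _ => by ring
  simp_rw [h]
  rw [integral_finsetSum _ fun n _ => (integrable_conj_mul g (φ n)).const_mul _]
  simp_rw [integral_const_mul, inner_L2_eq_integral]
  exact Finset.sum_congr rfl fun n _ => by ring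

lemma integral_sqrtKernel_mul_sqrtKernel (hφ : Orthonormal ℂ φ) (hlam : ∀ n, 0 ≤ lam n) (N : ℕ)
    (z z' : ℝ) :
    ∫ t in S.Zt, S.sqrtKernel lam φ N z t * S.sqrtKernel lam φ N t z' =
      ∑ n ∈ Finset.range N, (lam n : ℂ) * φ n z * conj (φ n z') := by
  have h : ∀ t, S.sqrtKernel lam φ N z t * S.sqrtKernel lam φ N t z' =
      ∑ m ∈ Finset.range N, (S.sqrtKernel lam φ N z t * φ m t) *
        ((Real.sqrt (lam m) : ℂ) * conj (φ m z')) := by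
    intro t
    conv_lhs => rw [sqrtKernel.eq_def S lam φ N t z']
    rw [Finset.mul_sum]
    exact Finset.sum_congr rfl fun m _ => by ring
  have hi : ∀ m, Integrable (fun t => S.sqrtKernel lam φ N z t * φ m t)
      (volume.restrict S.Zt) := by
    intro m
    simp_rw [sqrtKernel, Finset.sum_mul, mul_assoc]
    exact integrable_finsetSum _ fun n _ =>
      ((integrable_conj_mul (φ n) (φ m)).const_mul _).const_mul _
  simp_rw [h]
  rw [integral_finsetSum _ fun m _ => (hi m).mul_const _]
  refine Finset.sum_congr rfl fun m hm => ?_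
  rw [integral_mul_const, integral_sqrtKernel_mul, Finset.sum_eq_single m]
  · rw [inner_self_eq_norm_sq_to_K, hφ.1 m]
    have : ((lam m : ℝ) : ℂ) = (Real.sqrt (lam m) : ℂ) * (Real.sqrt (lam m) : ℂ) := by
      rw [← Complex.ofReal_mul, Real.mul_self_sqrt (hlam m)]
    rw [this]
    simp
    ring
  · intro n _ hn
    rw [hφ.2 hn, mul_zero]
  · exact fun h => absurd hm h

/-- The sesquilinear form of `Q`: with `R` the operator with kernel `sqrtKernel`, it is
`⟨R f, R g⟩ + L α_s γ_s G_r ⟨R f, h_s⟩ ⟨h_s, R g⟩`. -/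
lemma kernelForm_Qkernel (hφ : Orthonormal ℂ φ) (hlam : ∀ n, 0 ≤ lam n) (N : ℕ) (f g : L2 S.Zt) :
    kernelForm S.Zt (S.Qkernel lam φ N) f g =
      ∑ n ∈ Finset.range N, (lam n : ℂ) * inner ℂ f (φ n) * inner ℂ (φ n) g +
        S.sensingGain *
          (∑ n ∈ Finset.range N, (Real.sqrt (lam n) : ℂ) * inner ℂ f (φ n) * inner ℂ (φ n) S.hsTx) *
          (∑ n ∈ Finset.range N, (Real.sqrt (lam n) : ℂ) * inner ℂ S.hsTx (φ n) * inner ℂ (φ n) g) := by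
  have hae : S.hsTx =ᵐ[volume.restrict S.Zt] S.hs := S.memLp_hs_Zt.coeFn_toLp
  have h1 : ∀ z, ∫ z' in S.Zt, S.sqrtKernel lam φ N z z' * S.hs z' =
      ∑ n ∈ Finset.range N, (Real.sqrt (lam n) : ℂ) * φ n z * inner ℂ (φ n) S.hsTx := by
    intro z
    rw [← integral_sqrtKernel_mul]
    refine integral_congr_ae ?_
    filter_upwards [hae] with z' hz'
    rw [hz']
  have h2 : ∀ z, ∫ z' in S.Zt, conj (S.hs z') * S.sqrtKernel lam φ N z' z =
      ∑ n ∈ Finset.range N, (Real.sqrt (lam n) : ℂ) * inner ℂ S.hsTx (φ n) * conj (φ n z) := by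
    intro z
    rw [← integral_mul_sqrtKernel]
    refine integral_congr_ae ?_
    filter_upwards [hae] with z' hz'
    rw [hz']
  let C : ℕ × ℕ → ℂ := fun p => (if p.1 = p.2 then (lam p.1 : ℂ) else 0) + S.sensingGain *
    (Real.sqrt (lam p.1) * inner ℂ (φ p.1) S.hsTx) * (Real.sqrt (lam p.2) * inner ℂ S.hsTx (φ p.2))
  have hsplit : ∀ u v : ℕ → ℂ, ∑ p ∈ Finset.range N ×ˢ Finset.range N, C p * u p.1 * v p.2 =
      ∑ n ∈ Finset.range N, (lam n : ℂ) * u n * v n + S.sensingGain *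
        (∑ n ∈ Finset.range N, (Real.sqrt (lam n) : ℂ) * u n * inner ℂ (φ n) S.hsTx) *
        (∑ n ∈ Finset.range N, (Real.sqrt (lam n) : ℂ) * inner ℂ S.hsTx (φ n) * v n) := by
    intro u v
    rw [mul_assoc, Finset.sum_mul_sum, Finset.mul_sum, ← Finset.sum_add_distrib,
      Finset.sum_product]
    refine Finset.sum_congr rfl fun n hn => ?_
    simp only [C, add_mul, Finset.sum_add_distrib, Finset.mul_sum]
    congr 1
    · rw [Finset.sum_eq_single n]
      · simp
      · intro m _ hm
        simp [hm.symm]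
      · exact fun h => absurd hn h
    · exact Finset.sum_congr rfl fun m _ => by ring
  have hQ : S.Qkernel lam φ N = fun z z' => ∑ p ∈ Finset.range N ×ˢ Finset.range N,
      C p * φ p.1 z * conj (φ p.2 z') := by
    ext z z'
    rw [hsplit (fun n => φ n z) (fun n => conj (φ n z')), Qkernel,
      integral_sqrtKernel_mul_sqrtKernel hφ hlam, h1, h2]
    rfl
  rw [hQ, kernelForm_sum, hsplit (fun n => inner ℂ f (φ n)) (fun n => inner ℂ (φ n) g)]

/-! ### The eigenvectors of `Q` -/

lemma kernelForm_eigenvector {A : Set ℝ} {K : ℝ → ℝ → ℂ} {a : ℕ → ℝ} {χ : ℕ → L2 A}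
    (h : IsKernelEVD A K a χ) (f : L2 A) (k : ℕ) :
    kernelForm A K f (χ k) = a k * inner ℂ f (χ k) := by
  refine (h.expansion f (χ k)).unique ?_
  have h1 := hasSum_single (f := fun n => (a n : ℂ) * inner ℂ f (χ n) * inner ℂ (χ n) (χ k)) k
    (fun n hn => by rw [h.orthonormal.2 hn, mul_zero])
  simpa [inner_self_eq_norm_sq_to_K, h.orthonormal.1 k] using h1

variable {nu : ℕ → ℝ} {χ : ℕ → L2 S.Zt} {N : ℕ}

lemma inner_phi_sum (hφ : Orthonormal ℂ φ) (c : ℕ → ℂ) {m : ℕ} (hm : m < N) :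
    inner ℂ (φ m) (∑ n ∈ Finset.range N, c n • φ n) = c m := by
  rw [hφ.inner_right_sum c (Finset.mem_range.2 hm)]

/-- The eigenvectors of `Q` for nonzero eigenvalues lie in the span of the first `N` modes. -/
lemma eigenvector_mem_span (hφ : Orthonormal ℂ φ) (hlam : ∀ n, 0 ≤ lam n)
    (h : IsKernelEVD S.Zt (S.Qkernel lam φ N) nu χ) {k : ℕ} (hk : nu k ≠ 0) :
    ∑ n ∈ Finset.range N, (inner ℂ (φ n) (χ k) : ℂ) • φ n = χ k := by
  set p := ∑ n ∈ Finset.range N, (inner ℂ (φ n) (χ k) : ℂ) • φ n with hp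
  -- The residual `χ k - p` is orthogonal to the modes, so `Q` does not see it.
  have h1 : ∀ n < N, inner ℂ (χ k - p) (φ n) = (0 : ℂ) := by
    intro n hn
    rw [← inner_conj_symm, inner_sub_right, hp,
      inner_phi_sum hφ (fun n => inner ℂ (φ n) (χ k)) hn, sub_self, map_zero]
  have h2 : inner ℂ (χ k - p) (χ k) = (0 : ℂ) := by
    have h3 := kernelForm_eigenvector h (χ k - p) k
    rw [kernelForm_Qkernel hφ hlam, Finset.sum_eq_zero, Finset.sum_eq_zero (s := Finset.range N)
      (f := fun n => (Real.sqrt (lam n) : ℂ) * inner ℂ (χ k - p) (φ n) * inner ℂ (φ n) S.hsTx)] at h3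
    · have : (nu k : ℂ) ≠ 0 := by exact_mod_cast hk
      simpa [this] using h3.symm
    · intro n hn
      rw [h1 n (Finset.mem_range.1 hn)]; simp
    · intro n hn
      rw [h1 n (Finset.mem_range.1 hn)]; simp
  have h4 : inner ℂ (χ k - p) p = (0 : ℂ) := by
    conv_lhs => rw [hp, inner_sum]
    refine Finset.sum_eq_zero fun n hn => ?_
    rw [inner_smul_right, h1 n (Finset.mem_range.1 hn), mul_zero]
  have h5 : inner ℂ (χ k - p) (χ k - p) = (0 : ℂ) := by rw [inner_sub_right, h2, h4, sub_zero]
  exact (sub_eq_zero.1 (inner_self_eq_zero.1 h5)).symm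

lemma kernelForm_Qkernel_sum (hφ : Orthonormal ℂ φ) (hlam : ∀ n, 0 ≤ lam n) (c : ℕ → ℂ) :
    kernelForm S.Zt (S.Qkernel lam φ N) (∑ n ∈ Finset.range N, c n • φ n)
      (∑ n ∈ Finset.range N, c n • φ n) =
      ((∑ n ∈ Finset.range N, lam n * ‖c n‖ ^ 2 + S.sensingGain *
        ‖∑ n ∈ Finset.range N, (Real.sqrt (lam n) : ℂ) * c n * inner ℂ S.hsTx (φ n)‖ ^ 2 : ℝ) : ℂ) := by
  have h1 : ∀ n ∈ Finset.range N, inner ℂ (φ n) (∑ n ∈ Finset.range N, c n • φ n) = c n :=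
    fun n hn => inner_phi_sum hφ c (Finset.mem_range.1 hn)
  have h2 : ∀ n ∈ Finset.range N, inner ℂ (∑ n ∈ Finset.range N, c n • φ n) (φ n) = conj (c n) :=
    fun n hn => by rw [← inner_conj_symm, h1 n hn]
  have e1 : ∑ n ∈ Finset.range N, (Real.sqrt (lam n) : ℂ) *
      inner ℂ (∑ n ∈ Finset.range N, c n • φ n) (φ n) * inner ℂ (φ n) S.hsTx =
      conj (∑ n ∈ Finset.range N, (Real.sqrt (lam n) : ℂ) * c n * inner ℂ S.hsTx (φ n)) := by
    rw [map_sum]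
    refine Finset.sum_congr rfl fun n hn => ?_
    rw [h2 n hn, map_mul, map_mul, Complex.conj_ofReal, inner_conj_symm]
  have e2 : ∑ n ∈ Finset.range N, (Real.sqrt (lam n) : ℂ) * inner ℂ S.hsTx (φ n) *
      inner ℂ (φ n) (∑ n ∈ Finset.range N, c n • φ n) =
      ∑ n ∈ Finset.range N, (Real.sqrt (lam n) : ℂ) * c n * inner ℂ S.hsTx (φ n) := by
    refine Finset.sum_congr rfl fun n hn => ?_
    rw [h1 n hn]; ring
  rw [kernelForm_Qkernel hφ hlam, e1, e2, mul_assoc, Complex.conj_mul', Complex.ofReal_add]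
  congr 1
  · rw [Complex.ofReal_sum]
    refine Finset.sum_congr rfl fun n hn => ?_
    rw [h1 n hn, h2 n hn, mul_assoc, Complex.conj_mul']
    push_cast
    rfl
  · push_cast
    rfl

/-- The form of `Q` is positive definite on the `N`-dimensional span of the first modes, so it cannot
vanish on a vector of that span orthogonal to fewer than `N` eigenvectors. -/
lemma nu_pos_of_lt (hφ : Orthonormal ℂ φ) (hlam : ∀ n, 0 < lam n)
    (h : IsKernelEVD S.Zt (S.Qkernel lam φ N) nu χ) {k : ℕ} (hk : k < N) : 0 < nu k := by
  rcases (h.nonneg k).lt_or_eq with h0 | h0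
  · exact h0
  exfalso
  have hzero : ∀ n, k ≤ n → nu n = 0 := fun n hn =>
    le_antisymm ((h.antitone hn).trans h0.symm.le) (h.nonneg n)
  let T : (Fin N → ℂ) →ₗ[ℂ] (Fin k → ℂ) :=
    { toFun := fun c j => ∑ n, c n * inner ℂ (χ j) (φ n)
      map_add' := by
        intro c c'; ext n
        simp [add_mul, Finset.sum_add_distrib]
      map_smul' := by
        intro r c; ext n
        simp [Finset.mul_sum, mul_assoc] }
  obtain ⟨c, hcT, hc0⟩ := (Submodule.ne_bot_iff _).1 (T.ker_ne_bot_of_finrank_lt (by simpa using hk))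
  let d : ℕ → ℂ := fun n => if hn : n < N then c ⟨n, hn⟩ else 0
  have hd : ∀ n : Fin N, d n = c n := fun n => by simp [d]
  have horth : ∀ j < k, inner ℂ (χ j) (∑ n ∈ Finset.range N, d n • φ n) = (0 : ℂ) := by
    intro j hj
    have h1 := congrFun (LinearMap.mem_ker.1 hcT) ⟨j, hj⟩
    rw [inner_sum, Finset.sum_range]
    refine Eq.trans (Finset.sum_congr rfl fun n _ => ?_) h1
    rw [inner_smul_right, hd]
  have hform : kernelForm S.Zt (S.Qkernel lam φ N) (∑ n ∈ Finset.range N, d n • φ n)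
      (∑ n ∈ Finset.range N, d n • φ n) = 0 := by
    refine (h.expansion _ _).unique ?_
    convert hasSum_zero using 2 with n
    rcases lt_or_ge n k with hn | hn
    · rw [horth n hn, mul_zero]
    · rw [hzero n hn]; simp
  rw [kernelForm_Qkernel_sum hφ (fun n => (hlam n).le), Complex.ofReal_eq_zero] at hform
  have h1 : 0 ≤ S.sensingGain * ‖∑ n ∈ Finset.range N,
      (Real.sqrt (lam n) : ℂ) * d n * inner ℂ S.hsTx (φ n)‖ ^ 2 :=
    mul_nonneg S.sensingGain_pos.le (by positivity)
  have h2 : ∀ n ∈ Finset.range N, 0 ≤ lam n * ‖d n‖ ^ 2 :=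
    fun n _ => mul_nonneg (hlam n).le (by positivity)
  have h3 : ∑ n ∈ Finset.range N, lam n * ‖d n‖ ^ 2 = 0 := by
    have := Finset.sum_nonneg h2
    linarith
  rw [Finset.sum_eq_zero_iff_of_nonneg h2] at h3
  refine hc0 (funext fun n => ?_)
  have := h3 n (Finset.mem_range.2 n.2)
  rw [hd] at this
  simpa [(hlam n).ne'] using this

/-- More than `N` eigenvectors in the span of the first `N` modes would be linearly dependent. -/
lemma nu_eq_zero_of_le (hφ : Orthonormal ℂ φ) (hlam : ∀ n, 0 ≤ lam n)
    (h : IsKernelEVD S.Zt (S.Qkernel lam φ N) nu χ) {k : ℕ} (hk : N ≤ k) : nu k = 0 := by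
  by_contra h0
  have hpos : ∀ j ≤ k, nu j ≠ 0 := fun j hj =>
    (((h.nonneg k).lt_of_ne' h0).trans_le (h.antitone hj)).ne'
  let T : (Fin (k + 1) → ℂ) →ₗ[ℂ] (Fin N → ℂ) :=
    { toFun := fun c n => ∑ j, c j * inner ℂ (φ n) (χ j)
      map_add' := by
        intro c c'; ext n
        simp [add_mul, Finset.sum_add_distrib]
      map_smul' := by
        intro r c; ext n
        simp [Finset.mul_sum, mul_assoc] }
  obtain ⟨c, hcT, hc0⟩ := (Submodule.ne_bot_iff _).1
    (T.ker_ne_bot_of_finrank_lt (by simpa using Nat.lt_succ_of_le hk))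
  have hsum : ∑ j : Fin (k + 1), c j • χ j = 0 := by
    have h1 : ∀ j : Fin (k + 1), c j • χ j =
        ∑ n ∈ Finset.range N, (c j * inner ℂ (φ n) (χ j)) • φ n := by
      intro j
      conv_lhs => rw [← eigenvector_mem_span hφ hlam h (hpos j (Nat.lt_succ_iff.1 j.2)),
        Finset.smul_sum]
      simp_rw [smul_smul]
    simp_rw [h1]
    rw [Finset.sum_comm]
    refine Finset.sum_eq_zero fun n hn => ?_
    rw [← Finset.sum_smul]
    have := congrFun (LinearMap.mem_ker.1 hcT) ⟨n, Finset.mem_range.1 hn⟩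
    simp only [T, LinearMap.coe_mk, AddHom.coe_mk, Pi.zero_apply] at this
    rw [this, zero_smul]
  have hli := (h.orthonormal.comp (fun j : Fin (k + 1) => (j : ℕ)) Fin.val_injective).linearIndependent
  exact hc0 (funext fun j => Fintype.linearIndependent_iff.1 hli c hsum j)

lemma numNonzero_Qkernel (hφ : Orthonormal ℂ φ) (hlam : ∀ n, 0 < lam n)
    (h : IsKernelEVD S.Zt (S.Qkernel lam φ N) nu χ) : numNonzero nu = N := by
  have : {n | nu n ≠ 0} = (Finset.range N : Set ℕ) := by
    ext n
    simp only [Finset.coe_range, Set.mem_Iio]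
    refine ⟨fun hn => ?_, fun hn => (nu_pos_of_lt hφ hlam h hn).ne'⟩
    by_contra h1
    exact hn (nu_eq_zero_of_le hφ (fun n => (hlam n).le) h (not_lt.1 h1))
  rw [numNonzero, this, Set.ncard_coe_finset, Finset.card_range]

end System

/-! ### The generating function of `ξ` -/

/-- The geometric power series `∑ r^m X^m = 1 / (1 - r X)`. -/
noncomputable def geomSeries (r : ℝ) : PowerSeries ℝ := PowerSeries.mk fun m => r ^ m

lemma derivative_geomSeries (r : ℝ) :
    PowerSeries.derivative ℝ (geomSeries r) =
      geomSeries r * PowerSeries.mk fun i => r ^ (i + 1) := by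
  ext m
  rw [PowerSeries.coeff_derivative, PowerSeries.coeff_mul, geomSeries, PowerSeries.coeff_mk,
    Finset.sum_congr rfl (g := fun _ => r ^ (m + 1))]
  · simp [mul_comm]
  · intro p hp
    rw [Finset.HasAntidiagonal.mem_antidiagonal] at hp
    rw [PowerSeries.coeff_mk, PowerSeries.coeff_mk, ← pow_add, ← add_assoc, hp]

lemma derivative_prod_geomSeries (s : Finset ℕ) (r : ℕ → ℝ) :
    PowerSeries.derivative ℝ (∏ n ∈ s, geomSeries (r n)) =
      (∏ n ∈ s, geomSeries (r n)) * ∑ n ∈ s, PowerSeries.mk fun i => r n ^ (i + 1) := by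
  classical
  induction s using Finset.induction_on with
  | empty => simp
  | insert n s hn ih =>
    rw [Finset.prod_insert hn, Finset.sum_insert hn, Derivation.leibniz, ih, derivative_geomSeries]
    simp only [smul_eq_mul]
    ring

/-- The ratio `1 - a_N / a_n` in the recursion for `ξ`. -/
noncomputable def xiRatio (a : ℕ → ℝ) (N n : ℕ) : ℝ := 1 - a (N - 1) / a n

/-- The recursion for `ξ` expresses the logarithmic derivative of
`∑ ξ_m X^m = ∏ 1 / (1 - (1 - a_N / a_n) X)`. -/
lemma xi_eq_coeff (a : ℕ → ℝ) (N m : ℕ) :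
    xi a N m = PowerSeries.coeff m (∏ n ∈ Finset.range N, geomSeries (xiRatio a N n)) := by
  set F := ∏ n ∈ Finset.range N, geomSeries (xiRatio a N n) with hF
  induction m using Nat.strong_induction_on with
  | _ m ih =>
    cases m with
    | zero =>
      rw [xi, PowerSeries.coeff_zero_eq_constantCoeff_apply, hF, map_prod]
      simp [geomSeries, ← PowerSeries.coeff_zero_eq_constantCoeff_apply]
    | succ m =>
      have h := congrArg (PowerSeries.coeff m)
        (derivative_prod_geomSeries (Finset.range N) (xiRatio a N))
      rw [← hF, PowerSeries.coeff_derivative, PowerSeries.coeff_mul,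
        Finset.Nat.sum_antidiagonal_eq_sum_range_succ_mk] at h
      rw [xi, Fin.sum_univ_eq_sum_range (fun i => xi a N (m - i) *
        ∑ n ∈ Finset.range N, (1 - a (N - 1) / a n) ^ (i + 1)), ← Finset.sum_range_reflect]
      have hm : ((m : ℝ) + 1) ≠ 0 := by positivity
      rw [one_div, inv_mul_eq_div, div_eq_iff hm, h]
      refine Finset.sum_congr rfl fun i hi => ?_
      have him : i ≤ m := Nat.lt_succ_iff.1 (Finset.mem_range.1 hi)
      have e1 : m - (m + 1 - 1 - i) = i := by omega
      have e2 : m + 1 - 1 - i = m - i := by omega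
      rw [e1, e2, ih i (by omega), map_sum]
      simp [xiRatio]

lemma xi_nonneg {a : ℕ → ℝ} {N : ℕ} (ha : ∀ n < N, 0 ≤ xiRatio a N n) (m : ℕ) : 0 ≤ xi a N m := by
  induction m using Nat.strong_induction_on with
  | _ m ih =>
    cases m with
    | zero => rw [xi]; exact zero_le_one
    | succ m =>
      rw [xi]
      refine mul_nonneg (by positivity) (Finset.sum_nonneg fun i _ => mul_nonneg (ih _ (by omega))
        (Finset.sum_nonneg fun n hn => pow_nonneg (ha n (Finset.mem_range.1 hn)) _))

/-- Evaluation of a product of geometric series in the closed unit disk. -/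
lemma hasSum_coeff_prod_geomSeries (s : Finset ℕ) (r : ℕ → ℝ) (hr0 : ∀ n ∈ s, 0 ≤ r n)
    (hr1 : ∀ n ∈ s, r n < 1) {z : ℂ} (hz : ‖z‖ ≤ 1) :
    Summable (fun m => ‖((PowerSeries.coeff m (∏ n ∈ s, geomSeries (r n)) : ℝ) : ℂ) * z ^ m‖) ∧
      ∑' m, ((PowerSeries.coeff m (∏ n ∈ s, geomSeries (r n)) : ℝ) : ℂ) * z ^ m =
        ∏ n ∈ s, (1 - r n * z)⁻¹ := by
  classical
  induction s using Finset.induction_on with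
  | empty =>
    have h : ∀ m, m ≠ 0 →
        ((PowerSeries.coeff m (1 : PowerSeries ℝ) : ℝ) : ℂ) * z ^ m = 0 := by
      intro m hm
      rw [PowerSeries.coeff_one, if_neg hm]; simp
    rw [Finset.prod_empty, Finset.prod_empty]
    refine ⟨summable_of_ne_finset_zero (s := {0}) fun m hm => ?_, ?_⟩
    · rw [h m (by simpa using hm), norm_zero]
    · rw [tsum_eq_single 0 h]
      simp
  | insert n s hn ih =>
    have ih' := ih (fun n hn => hr0 n (Finset.mem_insert_of_mem hn))
      (fun n hn => hr1 n (Finset.mem_insert_of_mem hn))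
    have hr0n := hr0 n (Finset.mem_insert_self _ _)
    have hr1n := hr1 n (Finset.mem_insert_self _ _)
    have hnorm : ‖(r n : ℂ) * z‖ < 1 := by
      rw [norm_mul, Complex.norm_real, Real.norm_of_nonneg hr0n]
      calc r n * ‖z‖ ≤ r n * 1 := by gcongr
        _ < 1 := by simpa using hr1n
    have hg : Summable fun m => ‖((r n : ℂ) * z) ^ m‖ := by
      simp_rw [norm_pow]
      exact summable_geometric_of_lt_one (norm_nonneg _) hnorm
    have hc : ∀ m, ((PowerSeries.coeff m (∏ n ∈ insert n s, geomSeries (r n)) : ℝ) : ℂ) * z ^ m =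
        ∑ kl ∈ Finset.HasAntidiagonal.antidiagonal m, ((r n : ℂ) * z) ^ kl.1 *
          (((PowerSeries.coeff kl.2 (∏ n ∈ s, geomSeries (r n)) : ℝ) : ℂ) * z ^ kl.2) := by
      intro m
      rw [Finset.prod_insert hn, PowerSeries.coeff_mul, Complex.ofReal_sum, Finset.sum_mul]
      refine Finset.sum_congr rfl fun p hp => ?_
      rw [Finset.HasAntidiagonal.mem_antidiagonal] at hp
      rw [← hp, pow_add, geomSeries, PowerSeries.coeff_mk, mul_pow]
      push_cast
      ring
    simp_rw [hc]
    have h1 := tsum_mul_tsum_eq_tsum_sum_antidiagonal_of_summable_norm hg ih'.1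
    rw [ih'.2, tsum_geometric_of_norm_lt_one hnorm] at h1
    rw [Finset.prod_insert hn, h1]
    have h2 := summable_norm_sum_mul_antidiagonal_of_summable_norm hg ih'.1
    exact ⟨h2, rfl⟩

/-! ### The gamma distribution: characteristic function and logarithmic moment -/

lemma integrableOn_pow_mul_cexp {b : ℂ} (hb : 0 < b.re) (n : ℕ) :
    IntegrableOn (fun x : ℝ => (x : ℂ) ^ n * Complex.exp (-(b * x))) (Set.Ioi 0) := by
  have h := integrableOn_rpow_mul_exp_neg_mul_rpow (p := 1) (s := n) (b := b.re)
    (by linarith [(Nat.cast_nonneg n : (0 : ℝ) ≤ n)]) one_pos hb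
  refine Integrable.mono' h (by fun_prop) ?_
  refine (ae_restrict_iff' measurableSet_Ioi).2 (ae_of_all _ fun x hx => ?_)
  have hx0 : (0 : ℝ) < x := hx
  rw [norm_mul, norm_pow, Complex.norm_real, Real.norm_of_nonneg hx0.le, Complex.norm_exp,
    Real.rpow_natCast, Real.rpow_one]
  simp

lemma integral_pow_mul_cexp {b : ℂ} (hb : 0 < b.re) (n : ℕ) :
    ∫ x in Set.Ioi (0 : ℝ), (x : ℂ) ^ n * Complex.exp (-(b * x)) =
      (Nat.factorial n : ℂ) / b ^ (n + 1) := by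
  have hb0 : b ≠ 0 := by rintro rfl; simp at hb
  have hexp : ∀ x : ℝ, HasDerivAt (fun x : ℝ => Complex.exp (-(b * x)) / (-b))
      (Complex.exp (-(b * x))) x := by
    intro x
    have h1 : HasDerivAt (fun x : ℝ => -(b * x)) (-b) x := by
      have := ((Complex.ofRealCLM.hasDerivAt (x := x)).const_mul b).neg
      exact this.congr_deriv (by simp)
    refine (h1.cexp.div_const (-b)).congr_deriv ?_
    field_simp
  induction n with
  | zero =>
    have h := integral_exp_mul_complex_Ioi (a := -b) (by simpa using hb) 0
    simp only [pow_zero, one_mul, ← neg_mul]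
    rw [h]
    simp
  | succ n ih =>
    have hu : ∀ x : ℝ, HasDerivAt (fun x : ℝ => (x : ℂ) ^ (n + 1)) ((n + 1 : ℕ) * (x : ℂ) ^ n) x := by
      intro x
      have := (Complex.ofRealCLM.hasDerivAt (x := x)).pow (n + 1)
      exact this.congr_deriv (by simp)
    have hi := integrableOn_pow_mul_cexp hb n
    have h0 : Filter.Tendsto (fun x : ℝ => (x : ℂ) ^ (n + 1) * (Complex.exp (-(b * x)) / (-b)))
        Filter.atTop (nhds 0) := by
      rw [tendsto_zero_iff_norm_tendsto_zero]
      have h1 := (isLittleO_pow_exp_pos_mul_atTop (n + 1) hb).tendsto_div_nhds_zero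
      have h2 := h1.div_const ‖b‖
      rw [zero_div] at h2
      refine h2.congr' ?_
      filter_upwards [Filter.eventually_gt_atTop 0] with x hx
      rw [norm_mul, norm_pow, Complex.norm_real, Real.norm_of_nonneg hx.le, norm_div, norm_neg,
        Complex.norm_exp]
      simp [Real.exp_neg]
      field_simp
    have hzero : Filter.Tendsto (fun x : ℝ => (x : ℂ) ^ (n + 1) * (Complex.exp (-(b * x)) / (-b)))
        (nhdsWithin 0 (Set.Ioi 0)) (nhds 0) := by
      have hc : Continuous fun x : ℝ => (x : ℂ) ^ (n + 1) * (Complex.exp (-(b * x)) / (-b)) := by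
        fun_prop
      have := (hc.tendsto 0).mono_left (nhdsWithin_le_nhds (s := Set.Ioi 0))
      simpa using this
    have hi2 : IntegrableOn (fun x : ℝ => ((n + 1 : ℕ) * (x : ℂ) ^ n) *
        (Complex.exp (-(b * x)) / (-b))) (Set.Ioi 0) :=
      (hi.const_mul (((n + 1 : ℕ) : ℂ) / (-b))).congr (ae_of_all _ fun x => by
        simp only [div_eq_mul_inv]; ring)
    have := integral_Ioi_mul_deriv_eq_deriv_mul (fun x _ => hu x) (fun x _ => hexp x)
      (integrableOn_pow_mul_cexp hb (n + 1)) hi2 hzero h0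
    rw [this]
    have h3 : ∀ x : ℝ, ((n + 1 : ℕ) * (x : ℂ) ^ n) * (Complex.exp (-(b * x)) / (-b)) =
        (((n + 1 : ℕ) : ℂ) / (-b)) * ((x : ℂ) ^ n * Complex.exp (-(b * x))) := by
      intro x
      simp only [div_eq_mul_inv]; ring
    simp_rw [h3]
    rw [integral_const_mul, ih, Nat.factorial_succ]
    push_cast
    field_simp
    ring

lemma integral_gammaMeasure {E : Type*} [NormedAddCommGroup E] [NormedSpace ℝ E] {k r : ℝ}
    (hk : 0 < k) (hr : 0 < r) (f : ℝ → E) :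
    ∫ x, f x ∂gammaMeasure k r = ∫ x in Set.Ioi (0 : ℝ),
      (r ^ k / Real.Gamma k * x ^ (k - 1) * Real.exp (-(r * x))) • f x := by
  have h : gammaMeasure k r = volume.withDensity (fun x => ENNReal.ofReal (gammaPDFReal k r x)) := rfl
  rw [h, integral_withDensity_eq_integral_toReal_smul
    (measurable_gammaPDFReal k r).ennreal_ofReal (ae_of_all _ fun _ => ENNReal.ofReal_lt_top)]
  simp_rw [ENNReal.toReal_ofReal (gammaPDFReal_nonneg hk hr _)]
  rw [← setIntegral_eq_integral_of_forall_compl_eq_zero (s := Set.Ici 0),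
    integral_Ici_eq_integral_Ioi]
  · refine setIntegral_congr_fun measurableSet_Ioi fun x hx => ?_
    rw [gammaPDFReal, if_pos (le_of_lt hx)]
  · intro x hx
    rw [gammaPDFReal, if_neg (by simpa using hx), zero_smul]

lemma integrable_gammaMeasure_iff {E : Type*} [NormedAddCommGroup E] [NormedSpace ℝ E] {k r : ℝ}
    (hk : 0 < k) (hr : 0 < r) (f : ℝ → E) :
    Integrable f (gammaMeasure k r) ↔ IntegrableOn (fun x =>
      (r ^ k / Real.Gamma k * x ^ (k - 1) * Real.exp (-(r * x))) • f x) (Set.Ioi (0 : ℝ)) := by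
  have h : gammaMeasure k r = volume.withDensity (fun x => ENNReal.ofReal (gammaPDFReal k r x)) := rfl
  rw [h, integrable_withDensity_iff_integrable_smul'
    (measurable_gammaPDFReal k r).ennreal_ofReal (ae_of_all _ fun _ => ENNReal.ofReal_lt_top)]
  simp_rw [ENNReal.toReal_ofReal (gammaPDFReal_nonneg hk hr _)]
  rw [← integrableOn_iff_integrable_of_support_subset (s := Set.Ici 0),
    integrableOn_Ici_iff_integrableOn_Ioi]
  · refine integrableOn_congr_fun (fun x hx => ?_) measurableSet_Ioi
    rw [gammaPDFReal, if_pos (le_of_lt hx)]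
  · intro x hx
    by_contra h
    refine hx ?_
    show gammaPDFReal k r x • f x = 0
    rw [gammaPDFReal, if_neg (by simpa using h), zero_smul]

lemma charFun_gammaMeasure {k : ℕ} (hk : 0 < k) {r : ℝ} (hr : 0 < r) (t : ℝ) :
    charFun (gammaMeasure k r) t = (1 / (1 - t / r * Complex.I)) ^ k := by
  obtain ⟨n, rfl⟩ := Nat.exists_eq_succ_of_ne_zero hk.ne'
  have hb : 0 < ((r : ℂ) - t * Complex.I).re := by simpa using hr
  rw [charFun_apply_real, integral_gammaMeasure (by exact_mod_cast hk) hr]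
  have h : ∀ x ∈ Set.Ioi (0 : ℝ), (r ^ ((n.succ : ℕ) : ℝ) / Real.Gamma ((n.succ : ℕ) : ℝ) *
      x ^ (((n.succ : ℕ) : ℝ) - 1) * Real.exp (-(r * x))) • Complex.exp (t * x * Complex.I) =
      ((r : ℂ) ^ (n + 1) / (Nat.factorial n : ℂ)) *
        ((x : ℂ) ^ n * Complex.exp (-(((r : ℂ) - t * Complex.I) * x))) := by
    intro x _
    have h1 : (((n.succ : ℕ) : ℝ) - 1) = (n : ℝ) := by push_cast; ring
    have h2 : Complex.exp (-(((r : ℂ) - t * Complex.I) * x)) =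
        Complex.exp (-(r * x)) * Complex.exp (t * x * Complex.I) := by
      rw [← Complex.exp_add]; congr 1; ring
    have h3 : Real.Gamma ((n.succ : ℕ) : ℝ) = Nat.factorial n := by
      rw [Nat.cast_succ, Real.Gamma_nat_eq_factorial]
    rw [h1, h2, h3, Real.rpow_natCast, Real.rpow_natCast, Complex.real_smul]
    push_cast [Nat.succ_eq_add_one]
    rw [pow_succ]
    ring
  rw [setIntegral_congr_fun measurableSet_Ioi h, integral_const_mul, integral_pow_mul_cexp hb]
  have hf : (Nat.factorial n : ℂ) ≠ 0 := by exact_mod_cast (Nat.factorial_pos n).ne'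
  have hr0 : (r : ℂ) ≠ 0 := by exact_mod_cast hr.ne'
  have hb0 : (r : ℂ) - t * Complex.I ≠ 0 := by
    intro h0; rw [h0] at hb; simp at hb
  have e : (1 : ℂ) - t / r * Complex.I = (r - t * Complex.I) / r := by field_simp
  rw [e, one_div_div, div_pow]
  field_simp

/-- `ln y ≤ y - 1` at `y = x` and at `y = x^(-1/2)`. -/
lemma abs_log_le {x : ℝ} (hx : 0 < x) : |Real.log x| ≤ x + 2 * x ^ (-(1 / 2) : ℝ) := by
  have h1 : 0 < x ^ (-(1 / 2) : ℝ) := Real.rpow_pos_of_pos hx _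
  rw [abs_le]
  constructor
  · have h2 := Real.log_le_sub_one_of_pos h1
    rw [Real.log_rpow hx] at h2
    linarith
  · have := Real.log_le_sub_one_of_pos hx
    linarith

lemma integrable_rpow_gammaMeasure {k r s : ℝ} (hk : 0 < k) (hr : 0 < r) (hs : 0 < k + s) :
    Integrable (fun x => x ^ s) (gammaMeasure k r) := by
  rw [integrable_gammaMeasure_iff hk hr]
  have h := integrableOn_rpow_mul_exp_neg_mul_rpow (p := 1) (s := k - 1 + s) (b := r)
    (by linarith) one_pos hr
  refine (h.const_mul (r ^ k / Real.Gamma k)).congr ?_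
  refine (ae_restrict_iff' measurableSet_Ioi).2 (ae_of_all _ fun x hx => ?_)
  simp only [Real.rpow_add (show (0 : ℝ) < x from hx), Real.rpow_one, smul_eq_mul, neg_mul]
  ring

lemma ae_pos_gammaMeasure (k r : ℝ) : ∀ᵐ x ∂gammaMeasure k r, 0 < x := by
  have h : gammaMeasure k r = volume.withDensity (fun x => ENNReal.ofReal (gammaPDFReal k r x)) := rfl
  rw [h, ae_withDensity_iff (measurable_gammaPDFReal k r).ennreal_ofReal]
  have h0 : ∀ᵐ x : ℝ, x ≠ 0 := by simp [ae_iff]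
  filter_upwards [h0] with x hx hx2
  by_contra hneg
  have : x < 0 := lt_of_le_of_ne (not_lt.1 hneg) hx
  rw [gammaPDFReal, if_neg (not_le.2 this)] at hx2
  simp at hx2

lemma integrable_log_gammaMeasure {k r : ℝ} (hk : 1 ≤ k) (hr : 0 < r) :
    Integrable Real.log (gammaMeasure k r) := by
  have h1 := integrable_rpow_gammaMeasure (s := 1) (by linarith) hr (by linarith : 0 < k + 1)
  have h2 := integrable_rpow_gammaMeasure (s := -(1 / 2)) (by linarith) hr
    (by linarith : 0 < k + -(1 / 2))
  refine Integrable.mono' (h1.add (h2.const_mul 2)) Real.measurable_log.aestronglyMeasurable ?_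
  filter_upwards [ae_pos_gammaMeasure k r] with x hx
  rw [Real.norm_eq_abs]
  simpa using abs_log_le hx

lemma hasDerivAt_Gamma_of_pos {k : ℝ} (hk : 0 < k) :
    HasDerivAt Real.Gamma
      (∫ x in Set.Ioi (0 : ℝ), x ^ (k - 1) * (Real.log x * Real.exp (-x))) k := by
  have h1 := Complex.hasDerivAt_GammaIntegral (s := k) (by simpa using hk)
  have h2 : HasDerivAt Complex.Gamma
      (∫ t : ℝ in Set.Ioi 0, (t : ℂ) ^ ((k : ℂ) - 1) * (Real.log t * Real.exp (-t))) k := by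
    refine h1.congr_of_eventuallyEq ?_
    have : {s : ℂ | 0 < s.re} ∈ nhds (k : ℂ) :=
      (isOpen_lt continuous_const Complex.continuous_re).mem_nhds (by simpa using hk)
    filter_upwards [this] with s hs
    exact Complex.Gamma_eq_integral hs
  have h3 := h2.real_of_complex
  have h4 : (∫ t : ℝ in Set.Ioi 0, (t : ℂ) ^ ((k : ℂ) - 1) * (Real.log t * Real.exp (-t))) =
      ((∫ x in Set.Ioi (0 : ℝ), x ^ (k - 1) * (Real.log x * Real.exp (-x)) : ℝ) : ℂ) := by
    rw [← integral_complex_ofReal]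
    refine setIntegral_congr_fun measurableSet_Ioi fun x hx => ?_
    rw [← Complex.ofReal_one, ← Complex.ofReal_sub, ← Complex.ofReal_cpow (le_of_lt hx)]
    push_cast
    rfl
  rw [h4, Complex.ofReal_re] at h3
  exact h3

lemma digamma_eq {k : ℝ} (hk : 0 < k) : digamma k =
    (∫ x in Set.Ioi (0 : ℝ), x ^ (k - 1) * (Real.log x * Real.exp (-x))) / Real.Gamma k :=
  ((hasDerivAt_Gamma_of_pos hk).log (Real.Gamma_pos_of_pos hk).ne').deriv

lemma integral_log_gammaMeasure_one {k : ℝ} (hk : 0 < k) :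
    ∫ x, Real.log x ∂gammaMeasure k 1 = digamma k := by
  rw [integral_gammaMeasure hk one_pos, digamma_eq hk, ← integral_div]
  refine setIntegral_congr_fun measurableSet_Ioi fun x _ => ?_
  simp only [Real.one_rpow, one_mul, smul_eq_mul, div_eq_mul_inv]
  ring

/-- `E ln X = ψ(k) - ln r` for `X ~ Gamma(k, r)`. -/
lemma integral_log_gammaMeasure {k r : ℝ} (hk : 1 ≤ k) (hr : 0 < r) :
    ∫ x, Real.log x ∂gammaMeasure k r = digamma k - Real.log r := by
  have hk0 : 0 < k := by linarith
  have hp := isProbabilityMeasure_gammaMeasure hk0 one_pos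
  have h1 : ∫ x, (Real.log x - Real.log r) ∂gammaMeasure k 1 = digamma k - Real.log r := by
    rw [integral_sub (integrable_log_gammaMeasure hk one_pos) (integrable_const _),
      integral_log_gammaMeasure_one hk0]
    simp
  rw [← h1, integral_gammaMeasure hk0 hr, integral_gammaMeasure hk0 one_pos]
  have h2 := integral_comp_mul_left_Ioi (fun x => ((1 : ℝ) ^ k / Real.Gamma k * x ^ (k - 1) *
    Real.exp (-(1 * x))) • (Real.log x - Real.log r)) 0 hr
  rw [mul_zero] at h2
  rw [← mul_right_inj' (inv_ne_zero hr.ne')]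
  refine Eq.trans ?_ h2
  rw [← integral_const_mul]
  refine setIntegral_congr_fun measurableSet_Ioi fun x hx => ?_
  have hx0 : (0 : ℝ) < x := hx
  simp only [Real.one_rpow, one_mul, smul_eq_mul]
  rw [Real.log_mul hr.ne' hx0.ne', Real.mul_rpow hr.le hx0.le, Real.rpow_sub_one hr.ne']
  field_simp
  ring

/-! ### Weighted sums of squared moduli of independent complex Gaussian variables -/

lemma integral_cexp_norm_sq_complexGaussian (t : ℝ) :
    ∫ z, Complex.exp (t * (‖z‖ ^ 2 : ℝ) * Complex.I) ∂complexGaussian 1 =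
      (1 - t * Complex.I)⁻¹ := by
  rw [complexGaussian_eq_withDensity one_pos, integral_withDensity_eq_integral_toReal_smul
    (by fun_prop) (ae_of_all _ fun _ => ENNReal.ofReal_lt_top)]
  have hb : 0 < (1 - t * Complex.I).re := by simp
  have hb0 : 1 - t * Complex.I ≠ 0 := by
    intro h0; rw [h0] at hb; simp at hb
  have h : ∀ z : ℂ, (ENNReal.ofReal (complexGaussianPDF 1 z)).toReal •
      Complex.exp (t * (‖z‖ ^ 2 : ℝ) * Complex.I) =
      (Real.pi : ℂ)⁻¹ * Complex.exp (-(1 - t * Complex.I) * (‖z‖ : ℂ) ^ 2) := by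
    intro z
    have h2 : Complex.exp (-(1 - t * Complex.I) * (‖z‖ : ℂ) ^ 2) =
        Complex.exp (-(‖z‖ : ℂ) ^ 2) * Complex.exp (t * (‖z‖ ^ 2 : ℝ) * Complex.I) := by
      rw [← Complex.exp_add]; congr 1; push_cast; ring
    rw [ENNReal.toReal_ofReal (complexGaussianPDF_pos one_pos z).le, complexGaussianPDF, h2,
      Complex.real_smul]
    push_cast
    rw [div_one, mul_one, div_eq_mul_inv]
    ring
  simp_rw [h]
  rw [integral_const_mul, GaussianFourier.integral_cexp_neg_mul_sq_norm hb, Complex.finrank_real_complex]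
  have hpi : (Real.pi : ℂ) ≠ 0 := by exact_mod_cast Real.pi_ne_zero
  norm_num
  field_simp

lemma measurable_sum_norm_sq {N : ℕ} (a : Fin N → ℝ) :
    Measurable fun z : Fin N → ℂ => ∑ k, a k * ‖z k‖ ^ 2 :=
  Finset.measurable_sum _ fun k _ => ((measurable_pi_apply k).norm.pow_const 2).const_mul _

lemma charFun_pi_sum_norm_sq {N : ℕ} (a : Fin N → ℝ) (t : ℝ) :
    charFun ((Measure.pi fun _ : Fin N => complexGaussian 1).map
      fun z => ∑ k, a k * ‖z k‖ ^ 2) t = ∏ k, (1 - t * a k * Complex.I)⁻¹ := by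
  rw [charFun_apply_real, integral_map (measurable_sum_norm_sq a).aemeasurable (by fun_prop)]
  have h : ∀ z : Fin N → ℂ, Complex.exp (t * (∑ k, a k * ‖z k‖ ^ 2 : ℝ) * Complex.I) =
      ∏ k, Complex.exp ((t * a k : ℝ) * (‖z k‖ ^ 2 : ℝ) * Complex.I) := by
    intro z
    rw [← Complex.exp_sum]
    congr 1
    push_cast
    rw [Finset.mul_sum, Finset.sum_mul]
    exact Finset.sum_congr rfl fun k _ => by ring
  simp_rw [h]
  rw [integral_fintype_prod_eq_prod
    (f := fun k z => Complex.exp ((t * a k : ℝ) * (‖z‖ ^ 2 : ℝ) * Complex.I))]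
  simp_rw [integral_cexp_norm_sq_complexGaussian]
  push_cast
  rfl

/-- The squared modulus of a standard complex Gaussian variable is exponentially distributed. -/
lemma complexGaussian_map_norm_sq :
    (complexGaussian 1).map (fun z => ‖z‖ ^ 2) = gammaMeasure 1 1 := by
  have := isProbabilityMeasure_gammaMeasure (a := 1) (r := 1) one_pos one_pos
  refine Measure.ext_of_charFun (funext fun t => ?_)
  have h := charFun_gammaMeasure (k := 1) one_pos (r := 1) one_pos t
  rw [Nat.cast_one] at h
  rw [h, charFun_apply_real, integral_map (by fun_prop) (by fun_prop),
    integral_cexp_norm_sq_complexGaussian]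
  simp

lemma integrable_norm_sq_rpow_complexGaussian {s : ℝ} (hs : -1 < s) :
    Integrable (fun z => (‖z‖ ^ 2) ^ s) (complexGaussian 1) := by
  have h := integrable_rpow_gammaMeasure one_pos one_pos (by linarith : 0 < 1 + s)
  rw [← complexGaussian_map_norm_sq] at h
  exact h.comp_measurable (by fun_prop)

lemma ae_ne_zero_complexGaussian : ∀ᵐ z ∂complexGaussian 1, z ≠ 0 := by
  have h := ae_pos_gammaMeasure 1 1
  rw [← complexGaussian_map_norm_sq] at h
  filter_upwards [ae_of_ae_map (by fun_prop) h] with z hz h0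
  simp [h0] at hz

section

variable {a : ℕ → ℝ} {N : ℕ}

lemma le_of_antitone_last (ha : Antitone a) {n : ℕ} (hn : n < N) : a (N - 1) ≤ a n :=
  ha (by omega)

lemma xiRatio_nonneg (ha : Antitone a) (hpos : ∀ n < N, 0 < a n) {n : ℕ} (hn : n < N) :
    0 ≤ xiRatio a N n := by
  rw [xiRatio, sub_nonneg, div_le_one (hpos n hn)]
  exact le_of_antitone_last ha hn

lemma xiRatio_lt_one (hpos : ∀ n < N, 0 < a n) {n : ℕ} (hn : n < N) :
    xiRatio a N n < 1 := by
  rw [xiRatio, sub_lt_self_iff]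
  exact div_pos (hpos _ (by omega)) (hpos n hn)

lemma seriesPrefactor_pos (hpos : ∀ n < N, 0 < a n) (hN : 0 < N) : 0 < seriesPrefactor a N :=
  div_pos (pow_pos (hpos _ (by omega)) _)
    (Finset.prod_pos fun n hn => hpos n (Finset.mem_range.1 hn))

lemma hasSum_xi_mul_pow (ha : Antitone a) (hpos : ∀ n < N, 0 < a n) {z : ℂ} (hz : ‖z‖ ≤ 1) :
    HasSum (fun m => (xi a N m : ℂ) * z ^ m)
      (∏ n ∈ Finset.range N, (1 - xiRatio a N n * z)⁻¹) := by
  have h := hasSum_coeff_prod_geomSeries (Finset.range N) (xiRatio a N)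
    (fun n hn => xiRatio_nonneg ha hpos (Finset.mem_range.1 hn))
    (fun n hn => xiRatio_lt_one hpos (Finset.mem_range.1 hn)) hz
  simp_rw [← xi_eq_coeff] at h
  rw [← h.2]
  exact h.1.of_norm.hasSum

/-- The weights of the gamma laws in the mixture sum to `1`: the generating function of `ξ` at `1`
is `∏ a_n / a_N^N`. -/
lemma hasSum_mixture_weights (ha : Antitone a) (hpos : ∀ n < N, 0 < a n) (hN : 0 < N) :
    HasSum (fun m => seriesPrefactor a N * xi a N m) 1 := by
  have h := hasSum_xi_mul_pow (z := 1) ha hpos (by simp)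
  have h1 : ∏ n ∈ Finset.range N, (1 - xiRatio a N n * 1 : ℂ)⁻¹ = ((seriesPrefactor a N)⁻¹ : ℝ) := by
    rw [seriesPrefactor, inv_div]
    push_cast
    rw [← Finset.card_range N, ← Finset.prod_const, Finset.card_range, ← Finset.prod_div_distrib]
    refine Finset.prod_congr rfl fun n _ => ?_
    rw [xiRatio]
    push_cast
    rw [mul_one, sub_sub_cancel, inv_div]
  rw [h1] at h
  simp only [one_pow, mul_one] at h
  have h2 : HasSum (fun m => xi a N m) (seriesPrefactor a N)⁻¹ := by exact_mod_cast h
  have h3 := h2.mul_left (seriesPrefactor a N)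
  rwa [mul_inv_cancel₀ (seriesPrefactor_pos hpos hN).ne'] at h3

/-- The mixture `∑ₘ (a_N^N ξ_m / ∏ a_n) Gamma(N + m, 1 / a_N)`. -/
noncomputable def gammaMixture (a : ℕ → ℝ) (N : ℕ) : Measure ℝ :=
  Measure.sum fun m : ℕ => ENNReal.ofReal (seriesPrefactor a N * xi a N m) •
    gammaMeasure ((N + m : ℕ) : ℝ) (1 / a (N - 1))

lemma mixture_weight_nonneg (ha : Antitone a) (hpos : ∀ n < N, 0 < a n) (hN : 0 < N) (m : ℕ) :
    0 ≤ seriesPrefactor a N * xi a N m :=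
  mul_nonneg (seriesPrefactor_pos hpos hN).le (xi_nonneg (fun _ hn => xiRatio_nonneg ha hpos hn) m)

lemma isProbabilityMeasure_gammaMixture (ha : Antitone a) (hpos : ∀ n < N, 0 < a n)
    (hN : 0 < N) : IsProbabilityMeasure (gammaMixture a N) := by
  refine ⟨?_⟩
  have h : ∀ m : ℕ, gammaMeasure ((N + m : ℕ) : ℝ) (1 / a (N - 1)) Set.univ = 1 := fun m =>
    (isProbabilityMeasure_gammaMeasure (by positivity)
      (one_div_pos.2 (hpos _ (by omega)))).measure_univ
  rw [gammaMixture, Measure.sum_apply _ .univ]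
  simp only [Measure.smul_apply, smul_eq_mul, h, mul_one]
  rw [← ENNReal.ofReal_tsum_of_nonneg (mixture_weight_nonneg ha hpos hN)
    (hasSum_mixture_weights ha hpos hN).summable, (hasSum_mixture_weights ha hpos hN).tsum_eq,
    ENNReal.ofReal_one]

lemma hasSum_integral_gammaMixture {E : Type*} [NormedAddCommGroup E] [NormedSpace ℝ E]
    (ha : Antitone a) (hpos : ∀ n < N, 0 < a n) (hN : 0 < N)
    {f : ℝ → E} (hf : Integrable f (gammaMixture a N)) :
    HasSum (fun m : ℕ => (seriesPrefactor a N * xi a N m) •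
      ∫ x, f x ∂gammaMeasure ((N + m : ℕ) : ℝ) (1 / a (N - 1))) (∫ x, f x ∂gammaMixture a N) := by
  have h := hasSum_integral_measure hf
  simp_rw [integral_smul_measure, ENNReal.toReal_ofReal (mixture_weight_nonneg ha hpos hN _)] at h
  exact h

/-- **Moschopoulos' expansion**: a weighted sum of independent unit exponential variables is a
mixture of gamma variables. -/
lemma pi_complexGaussian_map_sum_norm_sq (ha : Antitone a) (hpos : ∀ n < N, 0 < a n)
    (hN : 0 < N) :
    (Measure.pi fun _ : Fin N => complexGaussian 1).map
      (fun z => ∑ k : Fin N, a k * ‖z k‖ ^ 2) = gammaMixture a N := by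
  have := isProbabilityMeasure_gammaMixture ha hpos hN
  have hpr : IsProbabilityMeasure ((Measure.pi fun _ : Fin N => complexGaussian 1).map
      (fun z => ∑ k : Fin N, a k * ‖z k‖ ^ 2)) :=
    Measure.isProbabilityMeasure_map (measurable_sum_norm_sq _).aemeasurable
  refine Measure.ext_of_charFun (funext fun t => ?_)
  have hb : 0 < a (N - 1) := hpos _ (by omega)
  have hb0 : (a (N - 1) : ℂ) ≠ 0 := by exact_mod_cast hb.ne'
  have hw : ∀ x : ℝ, (1 - t * x * Complex.I : ℂ) ≠ 0 := by
    intro x h0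
    have := congrArg Complex.re h0
    simp at this
  have hint : Integrable (fun x : ℝ => Complex.exp (t * x * Complex.I)) (gammaMixture a N) := by
    refine Integrable.of_bound (C := 1) (by fun_prop) (ae_of_all _ fun x => ?_)
    rw [← Complex.ofReal_mul, Complex.norm_exp_ofReal_mul_I]
  have h1 := hasSum_integral_gammaMixture ha hpos hN hint
  simp_rw [← charFun_apply_real] at h1
  have h2 : ∀ m : ℕ, charFun (gammaMeasure ((N + m : ℕ) : ℝ) (1 / a (N - 1))) t =
      (1 - t * a (N - 1) * Complex.I)⁻¹ ^ (N + m) := by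
    intro m
    rw [charFun_gammaMeasure (by omega) (one_div_pos.2 hb)]
    push_cast
    rw [div_div_eq_mul_div, div_one, one_div]
  simp_rw [h2] at h1
  set z : ℂ := (1 - t * a (N - 1) * Complex.I)⁻¹ with hz
  have hz1 : ‖z‖ ≤ 1 := by
    rw [hz, norm_inv]
    refine inv_le_one_of_one_le₀ ?_
    have := Complex.abs_re_le_norm (1 - t * a (N - 1) * Complex.I)
    simpa using this
  have h3 := (hasSum_xi_mul_pow ha hpos hz1).mul_left ((seriesPrefactor a N : ℂ) * z ^ N)
  have h4 : ∀ m : ℕ, (seriesPrefactor a N : ℂ) * z ^ N * ((xi a N m : ℂ) * z ^ m) =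
      (seriesPrefactor a N * xi a N m) • z ^ (N + m) := by
    intro m
    rw [Complex.real_smul, pow_add]
    push_cast
    ring
  simp_rw [h4] at h3
  rw [h1.unique h3, charFun_pi_sum_norm_sq (fun k : Fin N => a k),
    Fin.prod_univ_eq_prod_range (fun n => (1 - t * a n * Complex.I : ℂ)⁻¹) N, seriesPrefactor]
  push_cast
  rw [← Finset.card_range N, ← Finset.prod_const, ← Finset.prod_const, Finset.card_range,
    ← Finset.prod_div_distrib, ← Finset.prod_mul_distrib, ← Finset.prod_mul_distrib]
  refine Finset.prod_congr rfl fun n hn => ?_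
  have han : (a n : ℂ) ≠ 0 := by exact_mod_cast (hpos n (Finset.mem_range.1 hn)).ne'
  have hwb := hw (a (N - 1))
  have hwn := hw (a n)
  -- `z⁻¹ - (1 - a_N / a_n) = (a_N / a_n) (1 - i t a_n)`, multiplied by `z`.
  have e : (1 : ℂ) - xiRatio a N n * z = a (N - 1) / a n * z * (1 - t * a n * Complex.I) := by
    have hzw : z * (1 - t * a (N - 1) * Complex.I) = 1 := inv_mul_cancel₀ hwb
    rw [xiRatio]
    push_cast
    field_simp
    linear_combination (-(a n : ℂ)) * hzw
  have hz0 : z ≠ 0 := inv_ne_zero hwb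
  rw [e]
  field_simp

lemma ae_sum_norm_sq_pos (hpos : ∀ n < N, 0 < a n) (hN : 0 < N) :
    ∀ᵐ z ∂(Measure.pi fun _ : Fin N => complexGaussian 1),
      0 < ∑ k : Fin N, a k * ‖z k‖ ^ 2 := by
  have h := (measurePreserving_eval (fun _ : Fin N => complexGaussian 1)
    ⟨0, hN⟩).quasiMeasurePreserving.ae ae_ne_zero_complexGaussian
  filter_upwards [h] with z hz
  refine Finset.sum_pos' (fun k _ => mul_nonneg (hpos k k.2).le (sq_nonneg _))
    ⟨⟨0, hN⟩, Finset.mem_univ _, mul_pos (hpos _ hN) ?_⟩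
  have : z ⟨0, hN⟩ ≠ 0 := hz
  positivity

/-- The logarithm is dominated near `0` by the inverse modulus of a single coordinate. -/
lemma integrable_log_sum_norm_sq (hpos : ∀ n < N, 0 < a n) (hN : 0 < N) :
    Integrable (fun z : Fin N → ℂ => Real.log (∑ k : Fin N, a k * ‖z k‖ ^ 2))
      (Measure.pi fun _ : Fin N => complexGaussian 1) := by
  have hev : ∀ (s : ℝ), -1 < s → ∀ k : Fin N, Integrable (fun z : Fin N → ℂ => (‖z k‖ ^ 2) ^ s)
      (Measure.pi fun _ : Fin N => complexGaussian 1) := fun s hs k =>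
    (measurePreserving_eval (fun _ : Fin N => complexGaussian 1) k).integrable_comp_of_integrable
      (integrable_norm_sq_rpow_complexGaussian hs)
  have h1 : Integrable (fun z : Fin N → ℂ => ∑ k : Fin N, a k * ‖z k‖ ^ 2)
      (Measure.pi fun _ : Fin N => complexGaussian 1) := by
    refine integrable_finsetSum _ fun k _ => Integrable.const_mul ?_ _
    simpa using hev 1 (by norm_num) k
  have h2 := ((hev (-(1 / 2)) (by norm_num) ⟨0, hN⟩).const_mul (a 0 ^ (-(1 / 2) : ℝ))).const_mul 2
  refine Integrable.mono' (h1.add h2)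
    (Real.measurable_log.comp (measurable_sum_norm_sq _)).aestronglyMeasurable ?_
  have h0 := (measurePreserving_eval (fun _ : Fin N => complexGaussian 1)
    ⟨0, hN⟩).quasiMeasurePreserving.ae ae_ne_zero_complexGaussian
  filter_upwards [ae_sum_norm_sq_pos hpos hN, h0] with z hz hz0
  have hz0' : 0 < ‖z ⟨0, hN⟩‖ := norm_pos_iff.2 hz0
  refine (abs_log_le hz).trans (add_le_add le_rfl (mul_le_mul_of_nonneg_left ?_ zero_le_two))
  rw [← Real.mul_rpow (hpos 0 hN).le (sq_nonneg _)]
  refine Real.rpow_le_rpow_of_nonpos (mul_pos (hpos 0 hN) (by positivity)) ?_ (by norm_num)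
  exact Finset.single_le_sum (f := fun k : Fin N => a k * ‖z k‖ ^ 2)
    (fun k _ => mul_nonneg (hpos k k.2).le (sq_nonneg _)) (Finset.mem_univ ⟨0, hN⟩)

/-- The mean logarithm of a weighted sum of independent unit exponential variables. -/
lemma hasSum_seriesTerm (ha : Antitone a) (hpos : ∀ n < N, 0 < a n) (hN : 0 < N) :
    HasSum (fun m => seriesPrefactor a N * seriesTerm a N m)
      (∫ z : Fin N → ℂ, Real.log (∑ k : Fin N, a k * ‖z k‖ ^ 2)
        ∂(Measure.pi fun _ : Fin N => complexGaussian 1)) := by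
  have hb : 0 < a (N - 1) := hpos _ (by omega)
  have hm : Measurable fun z : Fin N → ℂ => ∑ k : Fin N, a k * ‖z k‖ ^ 2 :=
    measurable_sum_norm_sq _
  have hlog : Integrable Real.log (gammaMixture a N) := by
    rw [← pi_complexGaussian_map_sum_norm_sq ha hpos hN]
    exact (integrable_map_measure Real.measurable_log.aestronglyMeasurable hm.aemeasurable).2
      (integrable_log_sum_norm_sq hpos hN)
  have h := hasSum_integral_gammaMixture ha hpos hN hlog
  rw [← pi_complexGaussian_map_sum_norm_sq ha hpos hN,
    integral_map hm.aemeasurable Real.measurable_log.aestronglyMeasurable] at h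
  refine h.congr_fun fun m => ?_
  rw [integral_log_gammaMeasure (by exact_mod_cast (by omega : 1 ≤ N + m)) (one_div_pos.2 hb),
    one_div, Real.log_inv, sub_neg_eq_add, smul_eq_mul, seriesTerm]
  push_cast
  ring

lemma summable_seriesTerm (ha : Antitone a) (hpos : ∀ n < N, 0 < a n) (hN : 0 < N) :
    Summable (seriesTerm a N) :=
  (summable_mul_left_iff (seriesPrefactor_pos hpos hN).ne').1 (hasSum_seriesTerm ha hpos hN).summable

lemma integral_log_sum_norm_sq (ha : Antitone a) (hpos : ∀ n < N, 0 < a n) (hN : 0 < N) :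
    ∫ z : Fin N → ℂ, Real.log (∑ k : Fin N, a k * ‖z k‖ ^ 2)
        ∂(Measure.pi fun _ : Fin N => complexGaussian 1) =
      seriesPrefactor a N * ∑' m, seriesTerm a N m := by
  rw [← (hasSum_seriesTerm ha hpos hN).tsum_eq, tsum_mul_left]

end

/-! ### Gaussian coordinates of the channel -/

/-- **Cramér–Wold**: a random vector all of whose linear functionals have the law that they have
under `CN(0, I)` is standard complex Gaussian. -/
lemma map_eq_pi_complexGaussian {Ω : Type*} [MeasurableSpace Ω] {μ : Measure Ω}
    [IsProbabilityMeasure μ] {ι : Type*} [Fintype ι] [DecidableEq ι] {X : Ω → ι → ℂ}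
    (hX : AEMeasurable X μ)
    (h : ∀ c : ι → ℂ, μ.map (fun ω => ∑ k, c k * X ω k) = complexGaussian (∑ k, ‖c k‖ ^ 2)) :
    μ.map X = Measure.pi fun _ => complexGaussian 1 := by
  have := Measure.isProbabilityMeasure_map hX
  refine Measure.ext_of_charFunDual (funext fun T => ?_)
  rw [charFunDual_eq_charFun_map_one, charFunDual_eq_charFun_map_one]
  -- Every real-linear functional is the real part of a complex-linear one.
  obtain ⟨c, hc⟩ : ∃ c : ι → ℂ, ∀ k, c k =
      (T (Pi.single k 1) : ℂ) - (T (Pi.single k Complex.I) : ℂ) * Complex.I := ⟨_, fun _ => rfl⟩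
  have hT : ∀ x : ι → ℂ, T x = (∑ k, c k * x k).re := by
    intro x
    have hx : x = ∑ k, ((x k).re • (Pi.single k 1 : ι → ℂ) +
        (x k).im • (Pi.single k Complex.I : ι → ℂ)) := by
      ext j
      simp only [Finset.sum_apply, Pi.add_apply, Pi.smul_apply, Pi.single_apply]
      rw [Finset.sum_eq_single j]
      · simp
      · intro k _ hk
        simp [Ne.symm hk]
      · simp
    conv_lhs => rw [hx]
    rw [map_sum, Complex.re_sum]
    refine Finset.sum_congr rfl fun k _ => ?_
    rw [map_add, map_smul, map_smul, hc]
    simp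
    ring
  have hT' : (T : (ι → ℂ) → ℝ) = fun x => (∑ k, c k * x k).re := funext hT
  have hcs : ∀ m : Measure (ι → ℂ), m.map (fun x => (∑ k, c k * x k).re) =
      (m.map fun x => ∑ k, c k * x k).map Complex.re := by
    intro m
    rw [Measure.map_map Complex.measurable_re (by fun_prop)]
    rfl
  have hv : (0 : ℝ) ≤ ∑ k, ‖c k‖ ^ 2 := by positivity
  have hcm : Measurable fun x : ι → ℂ => ∑ k, c k * x k := by fun_prop
  rw [hT', hcs, hcs, AEMeasurable.map_map_of_aemeasurable hcm.aemeasurable hX]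
  have h1 : ((fun x : ι → ℂ => ∑ k, c k * x k) ∘ X) = fun ω => ∑ k, c k * X ω k := rfl
  rw [h1, h c, ← hcs, pi_complexGaussian_map_re_sum zero_le_one, charFun_gaussianReal, charFun_apply_real,
    integral_map (by fun_prop) (by fun_prop)]
  have h2 := charFun_map_re_mul_complexGaussian hv 1 1
  simp only [one_mul] at h2
  rw [h2, Real.coe_toNNReal _ (by positivity)]
  congr 1
  push_cast
  simp
  ring

namespace System

variable {S : System} {lam : ℕ → ℝ} {φ : ℕ → L2 S.Zt} {N : ℕ}

/-- The part of a realization `h` carried by the first `N` modes, each mode rescaled to unit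
variance. -/
noncomputable def whiten (S : System) (lam : ℕ → ℝ) (φ : ℕ → L2 S.Zt) (N : ℕ) (h : L2 S.Zt) :
    L2 S.Zt :=
  ∑ n ∈ Finset.range N, ((inner ℂ (φ n) h : ℂ) / (Real.sqrt (lam n) : ℂ)) • φ n

lemma inner_whiten (E h : L2 S.Zt) :
    inner ℂ E (S.whiten lam φ N h) = inner ℂ (S.whiten lam φ N E) h := by
  rw [whiten, whiten, inner_sum, sum_inner]
  refine Finset.sum_congr rfl fun n _ => ?_
  rw [inner_smul_right, inner_smul_left, map_div₀, Complex.conj_ofReal, inner_conj_symm]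
  ring

lemma norm_sq_sum_smul (hφ : Orthonormal ℂ φ) (c : ℕ → ℂ) :
    ‖∑ n ∈ Finset.range N, c n • φ n‖ ^ 2 = ∑ n ∈ Finset.range N, ‖c n‖ ^ 2 := by
  have h := hφ.inner_sum c c (Finset.range N)
  rw [inner_self_eq_norm_sq_to_K] at h
  have h2 : ((‖∑ n ∈ Finset.range N, c n • φ n‖ ^ 2 : ℝ) : ℂ) =
      ((∑ n ∈ Finset.range N, ‖c n‖ ^ 2 : ℝ) : ℂ) := by
    push_cast
    refine Eq.trans (by simp) (h.trans ?_)
    exact Finset.sum_congr rfl fun n _ => by rw [Complex.conj_mul']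
  exact_mod_cast h2

/-- The variance of the functional of the channel given by a combination of the first modes. -/
lemma kernelForm_channelCorr_sum (hl : IsKernelEVD S.Zt S.sincKernel lam φ) (c : ℕ → ℂ) :
    (kernelForm S.Zt S.channelCorr (∑ n ∈ Finset.range N, c n • φ n)
      (∑ n ∈ Finset.range N, c n • φ n)).re = ∑ n ∈ Finset.range N, lam n * ‖c n‖ ^ 2 := by
  have hK : S.channelCorr = S.sincKernel := by
    ext z z'
    exact S.channelCorr_eq z z'
  have h1 : ∀ n, n ∈ Finset.range N → inner ℂ (φ n) (∑ n ∈ Finset.range N, c n • φ n) = c n :=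
    fun n hn => inner_phi_sum hl.orthonormal c (Finset.mem_range.1 hn)
  have h2 : ∀ n, n ∉ Finset.range N → inner ℂ (φ n) (∑ n ∈ Finset.range N, c n • φ n) = 0 := by
    intro n hn
    rw [inner_sum]
    refine Finset.sum_eq_zero fun m hm => ?_
    rw [inner_smul_right, hl.orthonormal.2 (fun h => hn (by rw [h]; exact hm)), mul_zero]
  have h3 := hasSum_sum_of_ne_finset_zero (L := SummationFilter.unconditional ℕ) (s := Finset.range N)
    (f := fun n => (lam n : ℂ) * inner ℂ (∑ n ∈ Finset.range N, c n • φ n) (φ n) *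
      inner ℂ (φ n) (∑ n ∈ Finset.range N, c n • φ n))
    (fun n hn => by rw [h2 n hn, mul_zero])
  rw [hK, (hl.expansion _ _).unique h3, Complex.re_sum]
  refine Finset.sum_congr rfl fun n hn => ?_
  rw [← inner_conj_symm (∑ n ∈ Finset.range N, c n • φ n) (φ n), h1 n hn, mul_assoc,
    Complex.conj_mul']
  exact_mod_cast Complex.ofReal_re _

/-- The coordinates of the whitened channel in an orthonormal family of vectors of the span of the
first `N` modes are independent `CN(0, 1)` variables. -/
lemma map_inner_whiten {Ω : Type*} [MeasurableSpace Ω] {μ : Measure Ω} [IsProbabilityMeasure μ]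
    {hc : Ω → L2 S.Zt} (h_field : IsCircGaussianField μ S.Zt S.channelCorr hc)
    (hl : IsKernelEVD S.Zt S.sincKernel lam φ) {e : ℕ → L2 S.Zt} (he : Orthonormal ℂ e)
    (hspan : ∀ k < N, ∑ n ∈ Finset.range N, (inner ℂ (φ n) (e k) : ℂ) • φ n = e k) :
    AEMeasurable (fun ω (k : Fin N) => (inner ℂ (e k) (S.whiten lam φ N (hc ω)) : ℂ)) μ ∧
    μ.map (fun ω (k : Fin N) => (inner ℂ (e k) (S.whiten lam φ N (hc ω)) : ℂ)) =
      Measure.pi fun _ => complexGaussian 1 := by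
  have hX : AEMeasurable (fun ω (k : Fin N) => (inner ℂ (e k) (S.whiten lam φ N (hc ω)) : ℂ)) μ := by
    refine aemeasurable_pi_lambda _ fun k => ?_
    simp_rw [inner_whiten]
    -- The law of the functional is a probability measure; `Measure.map` would be `0` otherwise.
    refine AEMeasurable.of_map_ne_zero ?_
    rw [h_field]
    exact IsProbabilityMeasure.ne_zero _
  refine ⟨hX, map_eq_pi_complexGaussian hX fun c => ?_⟩
  set E := ∑ k : Fin N, conj (c k) • e k with hE
  have h1 : ∀ ω, ∑ k : Fin N, c k * (inner ℂ (e k) (S.whiten lam φ N (hc ω)) : ℂ) =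
      inner ℂ (S.whiten lam φ N E) (hc ω) := by
    intro ω
    rw [← inner_whiten, hE, sum_inner]
    exact Finset.sum_congr rfl fun k _ => by rw [inner_smul_left, Complex.conj_conj]
  simp_rw [h1]
  rw [h_field]
  congr 1
  have h2 : ∑ n ∈ Finset.range N, (inner ℂ (φ n) E : ℂ) • φ n = E := by
    have h3 : ∀ n, (inner ℂ (φ n) E : ℂ) • φ n =
        ∑ k : Fin N, conj (c k) • ((inner ℂ (φ n) (e k) : ℂ) • φ n) := by
      intro n
      rw [hE, inner_sum, Finset.sum_smul]
      exact Finset.sum_congr rfl fun k _ => by rw [inner_smul_right, mul_smul]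
    simp_rw [h3]
    rw [Finset.sum_comm, hE]
    refine Finset.sum_congr rfl fun k _ => ?_
    rw [← Finset.smul_sum, hspan k k.2]
  -- Both `φ` and `e` are orthonormal, so `E` has the same energy in either family.
  have h4 : ‖E‖ ^ 2 = ∑ k : Fin N, ‖c k‖ ^ 2 := by
    have h5 := norm_sq_sum_smul (N := N) he (fun n => if h : n < N then conj (c ⟨n, h⟩) else 0)
    rw [← Fin.sum_univ_eq_sum_range
        (fun n => (if h : n < N then conj (c ⟨n, h⟩) else 0) • e n),
      ← Fin.sum_univ_eq_sum_range
        (fun n => ‖(if h : n < N then conj (c ⟨n, h⟩) else 0 : ℂ)‖ ^ 2)] at h5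
    simpa [hE] using h5
  rw [whiten, kernelForm_channelCorr_sum hl, ← h4, ← h2, norm_sq_sum_smul hl.orthonormal]
  refine Finset.sum_congr rfl fun n hn => ?_
  have hpos := S.lam_pos hl n
  rw [h2, norm_div, Complex.norm_real, Real.norm_of_nonneg (Real.sqrt_nonneg _), div_pow,
    Real.sq_sqrt hpos.le]
  field_simp

lemma inner_phi_whiten (hφ : Orthonormal ℂ φ) (h : L2 S.Zt) {n : ℕ} (hn : n < N) :
    inner ℂ (φ n) (S.whiten lam φ N h) = inner ℂ (φ n) h / (Real.sqrt (lam n) : ℂ) :=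
  inner_phi_sum hφ (fun n => (inner ℂ (φ n) h : ℂ) / (Real.sqrt (lam n) : ℂ)) hn

lemma norm_truncate_sq (hφ : Orthonormal ℂ φ) (hlam : ∀ n, 0 < lam n) (h : L2 S.Zt) :
    ‖S.truncate φ N h‖ ^ 2 =
      ∑ k : Fin N, lam k * ‖(inner ℂ (φ k) (S.whiten lam φ N h) : ℂ)‖ ^ 2 := by
  rw [truncate, norm_sq_sum_smul hφ,
    ← Fin.sum_univ_eq_sum_range (fun n => ‖(inner ℂ (φ n) h : ℂ)‖ ^ 2)]
  refine Finset.sum_congr rfl fun k _ => ?_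
  have hpos := hlam k
  rw [inner_phi_whiten hφ h k.2, norm_div, Complex.norm_real,
    Real.norm_of_nonneg (Real.sqrt_nonneg _), div_pow, Real.sq_sqrt hpos.le]
  field_simp

/-- The energy of the truncated channel plus its weighted gain towards the target is the quadratic
form of `Q` at the whitened channel, hence diagonal in the eigenvectors of `Q`. -/
lemma norm_truncate_sq_add (hφ : Orthonormal ℂ φ) (hlam : ∀ n, 0 < lam n)
    {nu : ℕ → ℝ} {χ : ℕ → L2 S.Zt}
    (hnu : IsKernelEVD S.Zt (S.Qkernel lam φ N) nu χ) (h : L2 S.Zt) :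
    ‖S.truncate φ N h‖ ^ 2 + S.sensingGain * ‖(inner ℂ S.hsTx (S.truncate φ N h) : ℂ)‖ ^ 2 =
      ∑ k : Fin N, nu k * ‖(inner ℂ (χ k) (S.whiten lam φ N h) : ℂ)‖ ^ 2 := by
  have h1 := kernelForm_Qkernel_sum (N := N) hφ (fun n => (hlam n).le)
    (fun n => (inner ℂ (φ n) h : ℂ) / (Real.sqrt (lam n) : ℂ))
  rw [← whiten] at h1
  have h2 := hasSum_sum_of_ne_finset_zero (L := SummationFilter.unconditional ℕ) (s := Finset.range N)
    (f := fun n => (nu n : ℂ) * inner ℂ (S.whiten lam φ N h) (χ n) *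
      inner ℂ (χ n) (S.whiten lam φ N h))
    (fun n hn => by
      rw [nu_eq_zero_of_le hφ (fun n => (hlam n).le) hnu (by simpa using hn)]
      simp)
  rw [(hnu.expansion _ _).unique h2] at h1
  have h3 : ∑ n ∈ Finset.range N, (nu n : ℂ) * inner ℂ (S.whiten lam φ N h) (χ n) *
      inner ℂ (χ n) (S.whiten lam φ N h) =
      ((∑ n ∈ Finset.range N, nu n * ‖(inner ℂ (χ n) (S.whiten lam φ N h) : ℂ)‖ ^ 2 : ℝ) : ℂ) := by
    push_cast
    refine Finset.sum_congr rfl fun n _ => ?_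
    rw [← inner_conj_symm (S.whiten lam φ N h), mul_assoc, Complex.conj_mul']
  rw [h3] at h1
  have h4 := Complex.ofReal_injective h1
  rw [Fin.sum_univ_eq_sum_range
    (fun n => nu n * ‖(inner ℂ (χ n) (S.whiten lam φ N h) : ℂ)‖ ^ 2), h4, truncate,
    norm_sq_sum_smul hφ, inner_sum]
  congr 1
  · refine Finset.sum_congr rfl fun n _ => ?_
    have hpos := hlam n
    rw [norm_div, Complex.norm_real, Real.norm_of_nonneg (Real.sqrt_nonneg _), div_pow,
      Real.sq_sqrt hpos.le]
    field_simp
  · congr 3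
    refine Finset.sum_congr rfl fun n _ => ?_
    have hpos : (Real.sqrt (lam n) : ℂ) ≠ 0 := by
      exact_mod_cast (Real.sqrt_pos.2 (hlam n)).ne'
    rw [inner_smul_right]
    field_simp

/-! ### The communications-centric beamformer -/

lemma γc_pos (S : System) : 0 < S.γc := div_pos S.P_pos (pow_pos S.σc_pos 2)

/-- A communications-centric beamformer is matched to the channel, by the equality case of the
Cauchy–Schwarz inequality; this is its gain towards the target. -/
lemma norm_txGain_sq {h w : L2 S.Zt} (hh : h ≠ 0) (hw : S.IsCCBeamformer h w) :
    ‖S.txGain w‖ ^ 2 = ‖(inner ℂ S.hsTx h : ℂ)‖ ^ 2 / ‖h‖ ^ 2 := by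
  set u : L2 S.Zt := (Lp.memLp h).star.toLp (star h) with hu
  have hae : u =ᵐ[volume.restrict S.Zt] fun z => conj (h z) := (Lp.memLp h).star.coeFn_toLp
  have hin : ∀ v : L2 S.Zt, (inner ℂ u v : ℂ) = ∫ z in S.Zt, h z * v z := by
    intro v
    rw [hu, inner_L2_toLp_left]
    refine integral_congr_ae (ae_of_all _ fun z => ?_)
    simp
  have hnu : ‖u‖ = ‖h‖ := by
    rw [hu, Lp.norm_toLp, Lp.norm_def]
    congr 1
    exact eLpNorm_congr_norm_ae (ae_of_all _ fun z => by simp)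
  have hn0 : ‖h‖ ≠ 0 := norm_ne_zero_iff.2 hh
  have hu0 : u ≠ 0 := norm_ne_zero_iff.1 (hnu ▸ hn0)
  have hw0 : w ≠ 0 := by
    rintro rfl
    simpa using hw.1
  -- Compare with the matched beamformer `u / ‖u‖`.
  have hle : ‖u‖ ≤ ‖(inner ℂ u w : ℂ)‖ := by
    have h1 := hw.2 (((‖u‖ : ℂ)⁻¹) • u) (by
      rw [norm_smul, norm_inv, Complex.norm_real, norm_norm, inv_mul_cancel₀ (hnu ▸ hn0)])
    have h2 : ‖(inner ℂ u (((‖u‖ : ℂ)⁻¹) • u) : ℂ)‖ = ‖u‖ := by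
      rw [inner_smul_right, norm_mul, norm_inv, Complex.norm_real, norm_norm,
        inner_self_eq_norm_sq_to_K, norm_pow, RCLike.norm_ofReal, abs_norm]
      have := hnu ▸ hn0
      field_simp
    have hγ := S.γc_pos
    rw [commRate, commRate, ← hin, ← hin, h2,
      Real.logb_le_logb one_lt_two (by positivity) (by positivity)] at h1
    exact le_of_sq_le_sq (le_of_mul_le_mul_left (le_of_add_le_add_left h1) hγ) (norm_nonneg _)
  have heq : ‖(inner ℂ u w : ℂ)‖ = ‖u‖ * ‖w‖ :=
    le_antisymm (norm_inner_le_norm u w) (by rwa [hw.1, mul_one])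
  obtain ⟨r, hr0, hr⟩ := (norm_inner_eq_norm_iff hu0 hw0).1 heq
  have hr1 : ‖r‖ * ‖h‖ = 1 := by
    rw [← hnu, ← norm_smul, ← hr, hw.1]
  have htx : S.txGain w = r * inner ℂ h S.hsTx := by
    rw [txGain, hsTx, inner_L2_toLp_right, ← integral_const_mul]
    refine integral_congr_ae ?_
    have hsm := Lp.coeFn_smul r u
    rw [← hr] at hsm
    filter_upwards [hsm, hae] with z hz1 hz2
    rw [hz1, Pi.smul_apply, hz2, smul_eq_mul]
    ring
  rw [htx, norm_mul, mul_pow, norm_inner_symm, eq_div_iff (pow_ne_zero 2 hn0)]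
  calc ‖r‖ ^ 2 * ‖(inner ℂ S.hsTx h : ℂ)‖ ^ 2 * ‖h‖ ^ 2
      = ‖(inner ℂ S.hsTx h : ℂ)‖ ^ 2 * (‖r‖ * ‖h‖) ^ 2 := by ring
    _ = _ := by rw [hr1, one_pow, mul_one]

/-- The sensing rate of the communications-centric beamformer as a difference of logarithms. -/
lemma sensingRate_of_isCCBeamformer (κ : Measure (Fin S.L → ℂ)) [IsProbabilityMeasure κ]
    (hκ : ∀ᵐ s ∂κ, (1 / (S.L : ℝ)) * ∑ l, ‖s l‖ ^ 2 = 1) {h w : L2 S.Zt} (hh : h ≠ 0)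
    (hw : S.IsCCBeamformer h w) :
    S.sensingRate κ w = 1 / ((S.L : ℝ) * Real.log 2) *
      (Real.log (‖h‖ ^ 2 + S.sensingGain * ‖(inner ℂ S.hsTx h : ℂ)‖ ^ 2) - Real.log (‖h‖ ^ 2)) := by
  have hn : 0 < ‖h‖ ^ 2 := by
    have := norm_pos_iff.2 hh
    positivity
  have hg := S.sensingGain_pos
  rw [S.sensingRate_eq κ hκ, norm_txGain_sq hh hw, ← Real.log_div (by positivity) hn.ne',
    ← sensingGain]
  have e : (‖h‖ ^ 2 + S.sensingGain * ‖(inner ℂ S.hsTx h : ℂ)‖ ^ 2) / ‖h‖ ^ 2 =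
      1 + S.sensingGain * (‖(inner ℂ S.hsTx h : ℂ)‖ ^ 2 / ‖h‖ ^ 2) := by
    field_simp
  rw [e, one_div_mul_eq_div, div_div, mul_comm (Real.log 2), one_div_mul_eq_div]

end System

end CAPA

theorem theorem6 (S : CAPA.System)
    -- the law of the symbols, which have unit average power
    (κ : Measure (Fin S.L → ℂ)) [IsProbabilityMeasure κ]
    (hκ : ∀ᵐ s ∂κ, (1 / (S.L : ℝ)) * ∑ l, ‖s l‖ ^ 2 = 1)
    -- the fading channel
    {Ω : Type*} [MeasurableSpace Ω] (μ : Measure Ω) [IsProbabilityMeasure μ]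
    (hc : Ω → CAPA.L2 S.Zt)
    (h_field : CAPA.IsCircGaussianField μ S.Zt S.channelCorr hc)
    -- the eigendecomposition of the sinc kernel and the number of degrees of freedom
    (lam : ℕ → ℝ) (φ : ℕ → CAPA.L2 S.Zt)
    (h_lam : CAPA.IsKernelEVD S.Zt S.sincKernel lam φ)
    (DoF : ℕ) (DoF_pos : 0 < DoF) (h_DoF : |(DoF : ℝ) - 2 * S.Lt / S.wavelength| < 1)
    -- the eigendecomposition of `Q`
    (nu : ℕ → ℝ) (χ : ℕ → CAPA.L2 S.Zt)
    (h_nu : CAPA.IsKernelEVD S.Zt (S.Qkernel lam φ DoF) nu χ)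
    (DoFQ : ℕ) (h_DoFQ : DoFQ = CAPA.numNonzero nu)
    -- the communications-centric beamformer for the channel with `DoF` modes
    (wc : Ω → CAPA.L2 S.Zt)
    (h_wc : ∀ᵐ ω ∂μ, S.IsCCBeamformer (S.truncate φ DoF (hc ω)) (wc ω)) :
    Integrable (fun ω => S.sensingRate κ (wc ω)) μ ∧
    Summable (CAPA.seriesTerm nu DoFQ) ∧
    Summable (CAPA.seriesTerm lam DoF) ∧
    ∫ ω, S.sensingRate κ (wc ω) ∂μ =
      CAPA.seriesPrefactor nu DoFQ * Real.logb 2 (Real.exp 1) / (S.L : ℝ) *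
          ∑' m, CAPA.seriesTerm nu DoFQ m -
        CAPA.seriesPrefactor lam DoF * Real.logb 2 (Real.exp 1) / (S.L : ℝ) *
          ∑' m, CAPA.seriesTerm lam DoF m := by
  have hφ := h_lam.orthonormal
  have hlam : ∀ n, 0 < lam n := S.lam_pos h_lam
  have hlam' : ∀ n < DoF, 0 < lam n := fun n _ => hlam n
  have hnu : ∀ n < DoF, 0 < nu n := fun n hn => CAPA.System.nu_pos_of_lt hφ hlam h_nu hn
  have hQ : DoFQ = DoF := h_DoFQ.trans (CAPA.System.numNonzero_Qkernel hφ hlam h_nu)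
  rw [hQ]
  have h_span : ∀ k < DoF, ∑ n ∈ Finset.range DoF, (inner ℂ (φ n) (φ k) : ℂ) • φ n = φ k := by
    intro k hk
    rw [Finset.sum_eq_single_of_mem k (Finset.mem_range.2 hk)
      (fun n _ hn => by rw [hφ.2 hn, zero_smul]), inner_self_eq_norm_sq_to_K, hφ.1 k]
    simp
  obtain ⟨hX, hXlaw⟩ := CAPA.System.map_inner_whiten h_field h_lam hφ h_span
  obtain ⟨hY, hYlaw⟩ := CAPA.System.map_inner_whiten h_field h_lam h_nu.orthonormal
    (fun k hk => CAPA.System.eigenvector_mem_span hφ (fun n => (hlam n).le) h_nu (hnu k hk).ne')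
  set X := fun ω (k : Fin DoF) => (inner ℂ (φ k) (S.whiten lam φ DoF (hc ω)) : ℂ)
  set Y := fun ω (k : Fin DoF) => (inner ℂ (χ k) (S.whiten lam φ DoF (hc ω)) : ℂ)
  have hlog : ∀ a : ℕ → ℝ, Measurable fun z : Fin DoF → ℂ =>
      Real.log (∑ k : Fin DoF, a k * ‖z k‖ ^ 2) := fun a =>
    Real.measurable_log.comp (CAPA.measurable_sum_norm_sq _)
  have hXint : Integrable (fun ω => Real.log (∑ k : Fin DoF, lam k * ‖X ω k‖ ^ 2)) μ := by
    have h := CAPA.integrable_log_sum_norm_sq hlam' DoF_pos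
    rw [← hXlaw] at h
    exact (integrable_map_measure (hlog lam).aestronglyMeasurable hX).1 h
  have hYint : Integrable (fun ω => Real.log (∑ k : Fin DoF, nu k * ‖Y ω k‖ ^ 2)) μ := by
    have h := CAPA.integrable_log_sum_norm_sq hnu DoF_pos
    rw [← hYlaw] at h
    exact (integrable_map_measure (hlog nu).aestronglyMeasurable hY).1 h
  have hXval := CAPA.integral_log_sum_norm_sq h_lam.antitone hlam' DoF_pos
  rw [← hXlaw, integral_map hX (hlog lam).aestronglyMeasurable] at hXval
  have hYval := CAPA.integral_log_sum_norm_sq h_nu.antitone hnu DoF_pos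
  rw [← hYlaw, integral_map hY (hlog nu).aestronglyMeasurable] at hYval
  -- The truncated channel vanishes with probability zero.
  have hpos := CAPA.ae_sum_norm_sq_pos hlam' DoF_pos
  rw [← hXlaw] at hpos
  have hrate : (fun ω => S.sensingRate κ (wc ω)) =ᵐ[μ] fun ω => 1 / ((S.L : ℝ) * Real.log 2) *
      (Real.log (∑ k : Fin DoF, nu k * ‖Y ω k‖ ^ 2) -
        Real.log (∑ k : Fin DoF, lam k * ‖X ω k‖ ^ 2)) := by
    filter_upwards [h_wc, ae_of_ae_map hX hpos] with ω hw hp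
    have hn := CAPA.System.norm_truncate_sq (N := DoF) hφ hlam (hc ω)
    have hh : S.truncate φ DoF (hc ω) ≠ 0 := by
      rw [← norm_ne_zero_iff]
      intro h0
      rw [h0] at hn
      exact hp.ne (by simpa using hn)
    rw [CAPA.System.sensingRate_of_isCCBeamformer κ hκ hh hw,
      CAPA.System.norm_truncate_sq_add hφ hlam h_nu, hn]
  refine ⟨((hYint.sub hXint).const_mul _).congr hrate.symm,
    CAPA.summable_seriesTerm h_nu.antitone hnu DoF_pos,
    CAPA.summable_seriesTerm h_lam.antitone hlam' DoF_pos, ?_⟩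
  rw [integral_congr_ae hrate, integral_const_mul, integral_sub hYint hXint, hXval, hYval,
    Real.logb, Real.log_exp]
  have hL : (S.L : ℝ) ≠ 0 := by exact_mod_cast S.L_pos.ne'
  have h2 : Real.log 2 ≠ 0 := (Real.log_pos one_lt_two).ne'
  field_simp
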